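/- Let $a\colon\mathbb R\to(0,\infty)$ be differentiable with locally bounded derivative and suppose $\int_0^\infty a(x)^{-1}\,dx=\infty=\int_{-\infty}^0 a(x)^{-1}\,dx$. Let $\rho\colon\mathbb R\to(0,\infty)$ be a $C^\infty$-function and let $L_\infty=L_\infty(\mathbb R;\rho\,dx)$ be the space of complex-valued essentially bounded functions, with the weak$^*$ topology of the dual of $L_1(\mathbb R;\rho\,dx)$. Define operators on $L_\infty$ by $X_{\min}\varphi=a\varphi'$ with domain $D(X_{\min})=C_c^\infty(\mathbb R)$ and $X_{\max}\varphi=a\varphi'$ with domain $D(X_{\max})=C_c^1(\mathbb R)$, and set $H_{\min}=-X_{\min}^2$, $H_{\max}=-X_{\max}^2$, where $D(A^2)=\{\varphi\in D(A): A\varphi\in D(A)\}$. A bar denotes the weak$^*$ closure (the operator whose graph is the weak$^*\times$weak$^*$ closure of the graph). An operator $A$ generates a weak$^*$ continuous semigroup or group $(S_t)$ if $\varphi\in D(A)$ and $A\varphi=\eta$ exactly when $t^{-1}(\varphi-S_t\varphi)\to\eta$ in the weak$^*$ topology as $t\downarrow0$ (so that formally $S_t=e^{-tA}$). All members of such semigroups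 and groups are weak$^*$-weak$^*$ continuous linear operators. Then: (I) $X_{\min}$ and $X_{\max}$ are weak$^*$ closable and $\overline X_{\min}=\overline X_{\max}$. Moreover, the equation $\dot x=a(x)$ has a global flow $(t,x)\mapsto e^{tX}x$, the formula $(T_t\varphi)(y)=\varphi(e^{-tX}y)$ defines a weak$^*$ continuous one-parameter group $T$ on $L_\infty$, and $\overline X_{\max}$ generates $T$. (II) $H_{\max}$ is weak$^*$ closable and $\overline H_{\max}$ generates a semigroup $S$ which is weak$^*$ continuous, positive, contractive and holomorphic in the open right half-plane, i.e. $S$ extends to a family $(S_z)_{\operatorname{Re}z>0}$ of weak$^*$-weak$^*$ continuous operators such that $S_{z+w}=S_zS_w$, the map $z\mapsto S_z\varphi\in L_\infty$ is holomorphic for every $\varphi\in L_\infty$, and $S_z\varphi\to\varphi$ in the weak$^*$ topology as $z\to0$ in the sector $|\arg z|\le\theta$, for every $\theta<\pi/2$. (III) $\overline H_{\max}=-(\overline X_{\max})^2$ and, in particular, $(\overline X_{\max})^2$ is weak$^*$ closed. (IV) If $a\in C^\infty(\mathbb R)$ then $H_{\min}$ is weak$^*$ closable and $\overline H_{\min}=\overline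 H_{\max}$. -/

import Mathlib

open MeasureTheory Filter Topology
open scoped ENNReal ContDiff

noncomputable section

/-- The measure `ρ dx` on the real line. -/
def weightedMeasure (ρ : ℝ → ℝ) : Measure ℝ :=
  volume.withDensity (fun x => ENNReal.ofReal (ρ x))

/-- The duality `(φ, ψ) ↦ ∫ φ ψ dμ` between `L_∞(μ)` and `L_1(μ)` (complex-valued functions). -/
def linfPairing (μ : Measure ℝ) : Lp ℂ ∞ μ →ₗ[ℂ] Lp ℂ 1 μ →ₗ[ℂ] ℂ :=
  ((ContinuousLinearMap.mul ℂ ℂ).lpPairing μ ∞ 1).toLinearMap₁₂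

theorem linfPairing_apply (μ : Measure ℝ) (φ : Lp ℂ ∞ μ) (ψ : Lp ℂ 1 μ) :
    linfPairing μ φ ψ = ∫ x, φ x * ψ x ∂μ := by
  change (ContinuousLinearMap.mul ℂ ℂ).lpPairing μ ∞ 1 φ ψ = _
  rw [ContinuousLinearMap.lpPairing_eq_integral]
  rfl

/-- The vector space `L_∞(μ)` with its weak* topology, i.e. the coarsest topology for which all
the functionals `φ ↦ ∫ φ ψ dμ` with `ψ ∈ L_1(μ)` are continuous. -/
abbrev WeakStarLinf (μ : Measure ℝ) : Type := WeakBilin (linfPairing μ)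

/-- The identity map from `L_∞` with the weak* topology to `L_∞` as a normed space of
(equivalence classes of) functions. -/
def toLinf {μ : Measure ℝ} : WeakStarLinf μ ≃ₗ[ℂ] Lp ℂ ∞ μ := LinearEquiv.refl ℂ (Lp ℂ ∞ μ)

/-- The square `A ∘ A` of a partially defined operator, with its natural domain
`{x ∈ D(A) | A x ∈ D(A)}`. -/
def pmapSq {V : Type*} [AddCommGroup V] [Module ℂ V] (A : V →ₗ.[ℂ] V) : V →ₗ.[ℂ] V where
  domain :=
    { carrier := {x | ∃ h : x ∈ A.domain, A ⟨x, h⟩ ∈ A.domain}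
      zero_mem' := ⟨A.domain.zero_mem, by
        have : A ⟨0, A.domain.zero_mem⟩ = 0 := A.map_zero
        rw [this]; exact A.domain.zero_mem⟩
      add_mem' := by
        rintro x y ⟨hx, hx'⟩ ⟨hy, hy'⟩
        refine ⟨A.domain.add_mem hx hy, ?_⟩
        have : A ⟨x + y, A.domain.add_mem hx hy⟩ = A ⟨x, hx⟩ + A ⟨y, hy⟩ :=
          A.map_add ⟨x, hx⟩ ⟨y, hy⟩
        rw [this]; exact A.domain.add_mem hx' hy'
      smul_mem' := by
        rintro c x ⟨hx, hx'⟩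
        refine ⟨A.domain.smul_mem c hx, ?_⟩
        have : A ⟨c • x, A.domain.smul_mem c hx⟩ = c • A ⟨x, hx⟩ := A.map_smul c ⟨x, hx⟩
        rw [this]; exact A.domain.smul_mem c hx' }
  toFun :=
    { toFun := fun x => A ⟨A ⟨x.1, x.2.1⟩, x.2.2⟩
      map_add' := by
        rintro ⟨x, hx, hx'⟩ ⟨y, hy, hy'⟩
        rw [← A.map_add]
        congr 1
        exact Subtype.ext (A.map_add ⟨x, hx⟩ ⟨y, hy⟩)
      map_smul' := by
        rintro c ⟨x, hx, hx'⟩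
        rw [RingHom.id_apply, ← A.map_smul]
        congr 1
        exact Subtype.ext (A.map_smul c ⟨x, hx⟩) }

/-- The graph of the vector field `X = a d/dx` on `L_∞(ρ dx)` with domain `C_c^n(ℝ)`: the pairs
(class of `u`, class of `a u'`) with `u : ℝ → ℂ` of class `C^n` and compactly supported. -/
def vectorFieldGraph (a ρ : ℝ → ℝ) (n : WithTop ℕ∞) (hn : 1 ≤ n) :
    Submodule ℂ (WeakStarLinf (weightedMeasure ρ) × WeakStarLinf (weightedMeasure ρ)) where
  carrier := {p | ∃ u : ℝ → ℂ, ContDiff ℝ n u ∧ HasCompactSupport u ∧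
    toLinf p.1 =ᵐ[weightedMeasure ρ] u ∧
    toLinf p.2 =ᵐ[weightedMeasure ρ] fun x => (a x : ℂ) * deriv u x}
  zero_mem' := by
    refine ⟨0, contDiff_const, HasCompactSupport.zero, ?_, ?_⟩
    · simpa using Lp.coeFn_zero ℂ ∞ (weightedMeasure ρ)
    · have h := Lp.coeFn_zero ℂ ∞ (weightedMeasure ρ)
      filter_upwards [h] with x hx
      simpa using hx
  add_mem' := by
    rintro ⟨f, g⟩ ⟨f', g'⟩ ⟨u, hu, hc, hf, hg⟩ ⟨v, hv, hd, hf', hg'⟩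
    have hn0 : n ≠ 0 := fun h => by simp [h] at hn
    refine ⟨u + v, hu.add hv, hc.add hd, ?_, ?_⟩
    · have h := Lp.coeFn_add (toLinf f) (toLinf f')
      filter_upwards [h, hf, hf'] with x hx h1 h2
      simp only [Prod.mk_add_mk, _root_.map_add]
      rw [hx, Pi.add_apply, Pi.add_apply, h1, h2]
    · have h := Lp.coeFn_add (toLinf g) (toLinf g')
      filter_upwards [h, hg, hg'] with x hx h1 h2
      simp only [Prod.mk_add_mk, _root_.map_add]
      rw [hx, Pi.add_apply, h1, h2,
        deriv_add (hu.differentiable hn0 x) (hv.differentiable hn0 x)]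
      ring
  smul_mem' := by
    rintro c ⟨f, g⟩ ⟨u, hu, hc, hf, hg⟩
    have hn0 : n ≠ 0 := fun h => by simp [h] at hn
    refine ⟨c • u, contDiff_const.smul hu, hc.smul_left (f := fun _ => c), ?_, ?_⟩
    · have h := Lp.coeFn_smul c (toLinf f)
      filter_upwards [h, hf] with x hx h1
      simp only [Prod.smul_mk, _root_.map_smul]
      rw [hx, Pi.smul_apply, Pi.smul_apply, h1]
    · have h := Lp.coeFn_smul c (toLinf g)
      filter_upwards [h, hg] with x hx h1
      simp only [Prod.smul_mk, _root_.map_smul]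
      rw [hx, Pi.smul_apply, h1, deriv_const_smul c (hu.differentiable hn0 x)]
      simp only [smul_eq_mul]
      ring

/-- The vector field `X = a d/dx` as a partially defined operator on `L_∞(ρ dx)` with domain
`C_c^n(ℝ)` (see `vectorField_graph` and `mem_vectorField_domain` below). -/
def vectorField (a ρ : ℝ → ℝ) (n : WithTop ℕ∞) (hn : 1 ≤ n) :
    WeakStarLinf (weightedMeasure ρ) →ₗ.[ℂ] WeakStarLinf (weightedMeasure ρ) :=
  (vectorFieldGraph a ρ n hn).toLinearPMap

theorem volume_absolutelyContinuous_weightedMeasure {ρ : ℝ → ℝ} (hρ : ∀ x, 0 < ρ x)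
    (hρc : Continuous ρ) : (volume : Measure ℝ) ≪ weightedMeasure ρ :=
  withDensity_absolutelyContinuous'
    (ENNReal.measurable_ofReal.comp hρc.measurable).aemeasurable
    (ae_of_all _ fun x => by simpa using hρ x)

/-- For a positive continuous density the operator really has the prescribed graph. -/
theorem vectorField_graph (a : ℝ → ℝ) {ρ : ℝ → ℝ} (hρ : ∀ x, 0 < ρ x) (hρc : Continuous ρ)
    (n : WithTop ℕ∞) (hn : 1 ≤ n) :
    (vectorField a ρ n hn).graph = vectorFieldGraph a ρ n hn := by
  refine Submodule.toLinearPMap_graph_eq _ ?_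
  rintro ⟨f, g⟩ ⟨u, hu, -, hf, hg⟩ h0
  have h0' : f = 0 := h0
  subst h0'
  have hvol := volume_absolutelyContinuous_weightedMeasure hρ hρc
  have hz : (toLinf (0 : WeakStarLinf (weightedMeasure ρ)) : ℝ → ℂ) =ᵐ[weightedMeasure ρ] 0 :=
    Lp.coeFn_zero ℂ ∞ (weightedMeasure ρ)
  have hu0 : u =ᵐ[(volume : Measure ℝ)] (0 : ℝ → ℂ) := hvol.ae_eq (hf.symm.trans hz)
  have hu1 : u = 0 := (hu.continuous.ae_eq_iff_eq volume continuous_zero).1 hu0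
  subst hu1
  have hg0 : toLinf g = 0 := by
    refine Lp.ext ?_
    filter_upwards [hg, Lp.coeFn_zero ℂ ∞ (weightedMeasure ρ)] with x hx hx0
    rw [hx0]
    simpa using hx
  exact toLinf.map_eq_zero_iff.1 hg0

/-- For continuous `a` and a positive continuous density, the domain consists exactly of the
classes of the functions in `C_c^n(ℝ)`. -/
theorem mem_vectorField_domain {a ρ : ℝ → ℝ} (ha : Continuous a) (hρ : ∀ x, 0 < ρ x)
    (hρc : Continuous ρ) (n : WithTop ℕ∞) (hn : 1 ≤ n) (f : WeakStarLinf (weightedMeasure ρ)) :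
    f ∈ (vectorField a ρ n hn).domain ↔ ∃ u : ℝ → ℂ, ContDiff ℝ n u ∧ HasCompactSupport u ∧
      toLinf f =ᵐ[weightedMeasure ρ] u := by
  rw [LinearPMap.mem_domain_iff, vectorField_graph a hρ hρc]
  constructor
  · rintro ⟨g, u, hu, hc, hf, -⟩
    exact ⟨u, hu, hc, hf⟩
  · rintro ⟨u, hu, hc, hf⟩
    have hv : Continuous fun x => (a x : ℂ) * deriv u x :=
      (Complex.continuous_ofReal.comp ha).mul (hu.continuous_deriv hn)
    have hvc : HasCompactSupport fun x => (a x : ℂ) * deriv u x := hc.deriv.mul_left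
    obtain ⟨C, hC⟩ := hvc.exists_bound_of_continuous hv
    have hm : MemLp (fun x => (a x : ℂ) * deriv u x) ∞ (weightedMeasure ρ) :=
      memLp_top_of_bound hv.aestronglyMeasurable C (ae_of_all _ hC)
    exact ⟨toLinf.symm (hm.toLp _), u, hu, hc, hf, hm.coeFn_toLp⟩

/-- `X_min = a d/dx` on `L_∞(ρ dx)` with domain `C_c^∞(ℝ)`. -/
def opXmin (a ρ : ℝ → ℝ) :
    WeakStarLinf (weightedMeasure ρ) →ₗ.[ℂ] WeakStarLinf (weightedMeasure ρ) :=
  vectorField a ρ ∞ (by norm_cast)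

/-- `X_max = a d/dx` on `L_∞(ρ dx)` with domain `C_c^1(ℝ)`. -/
def opXmax (a ρ : ℝ → ℝ) :
    WeakStarLinf (weightedMeasure ρ) →ₗ.[ℂ] WeakStarLinf (weightedMeasure ρ) :=
  vectorField a ρ 1 le_rfl

/-- `H_min = -X_min²`. -/
def opHmin (a ρ : ℝ → ℝ) :
    WeakStarLinf (weightedMeasure ρ) →ₗ.[ℂ] WeakStarLinf (weightedMeasure ρ) :=
  -pmapSq (opXmin a ρ)

/-- `H_max = -X_max²`. -/
def opHmax (a ρ : ℝ → ℝ) :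
    WeakStarLinf (weightedMeasure ρ) →ₗ.[ℂ] WeakStarLinf (weightedMeasure ρ) :=
  -pmapSq (opXmax a ρ)

/-- `Φ t x = e^{tX} x` is the global flow of the differential equation `ẋ = a(x)`. -/
structure IsFlow (a : ℝ → ℝ) (Φ : ℝ → ℝ → ℝ) : Prop where
  initial : ∀ x, Φ 0 x = x
  ode : ∀ t x, HasDerivAt (fun s => Φ s x) (a (Φ t x)) t

/-- `T` is the family of operators `(T_t φ)(y) = φ(e^{-tX} y)` on `L_∞(μ)`. The first field says
that these formulas respect almost everywhere equality. -/
structure IsFlowPullback {μ : Measure ℝ} (Φ : ℝ → ℝ → ℝ)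
    (T : ℝ → WeakStarLinf μ →L[ℂ] WeakStarLinf μ) : Prop where
  quasi : ∀ t, Measure.QuasiMeasurePreserving (Φ t) μ μ
  apply : ∀ t φ, toLinf (T t φ) =ᵐ[μ] fun y => toLinf φ (Φ (-t) y)

/-- A weak* continuous one-parameter group on `L_∞(μ)`. Each `T t` is a weak*-weak* continuous
operator by its type. -/
structure IsWeakStarGroup {μ : Measure ℝ}
    (T : ℝ → WeakStarLinf μ →L[ℂ] WeakStarLinf μ) : Prop where
  zero : T 0 = ContinuousLinearMap.id ℂ _
  add : ∀ s t, T (s + t) = (T s).comp (T t)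
  continuous : ∀ φ, Continuous fun t => T t φ

/-- A weak* continuous one-parameter semigroup `(S_t)_{t ≥ 0}` on `L_∞(μ)`. Each `S t` is a
weak*-weak* continuous operator by its type; the values at negative `t` play no role. -/
structure IsWeakStarSemigroup {μ : Measure ℝ}
    (S : ℝ → WeakStarLinf μ →L[ℂ] WeakStarLinf μ) : Prop where
  zero : S 0 = ContinuousLinearMap.id ℂ _
  add : ∀ s t, 0 ≤ s → 0 ≤ t → S (s + t) = (S s).comp (S t)
  continuousOn : ∀ φ, ContinuousOn (fun t => S t φ) (Set.Ici 0)

/-- `A` is the weak* generator of `S`, with the sign convention `S_t = e^{-tA}`: the domain of `A`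
consists of all `φ` for which the weak* limit of `t⁻¹ (φ - S_t φ)` as `t ↓ 0` exists, and `A φ` is
that limit. -/
def IsWeakStarGenerator {μ : Measure ℝ} (A : WeakStarLinf μ →ₗ.[ℂ] WeakStarLinf μ)
    (S : ℝ → WeakStarLinf μ →L[ℂ] WeakStarLinf μ) : Prop :=
  ∀ φ η : WeakStarLinf μ, (φ, η) ∈ A.graph ↔
    Tendsto (fun t : ℝ => ((t : ℂ)⁻¹) • (φ - S t φ)) (𝓝[>] 0) (𝓝 η)

/-- Each `S_t`, `t ≥ 0`, maps (almost everywhere) nonnegative functions to nonnegative ones. -/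
def IsPositiveFamily {μ : Measure ℝ} (S : ℝ → WeakStarLinf μ →L[ℂ] WeakStarLinf μ) : Prop :=
  ∀ t, 0 ≤ t → ∀ φ : WeakStarLinf μ,
    (∀ᵐ x ∂μ, 0 ≤ (toLinf φ x).re ∧ (toLinf φ x).im = 0) →
      ∀ᵐ x ∂μ, 0 ≤ (toLinf (S t φ) x).re ∧ (toLinf (S t φ) x).im = 0

/-- Each `S_t`, `t ≥ 0`, is a contraction for the `L_∞`-norm. -/
def IsContractiveFamily {μ : Measure ℝ} (S : ℝ → WeakStarLinf μ →L[ℂ] WeakStarLinf μ) : Prop :=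
  ∀ t, 0 ≤ t → ∀ φ : WeakStarLinf μ, ‖toLinf (S t φ)‖ ≤ ‖toLinf φ‖

/-- The weak* semigroup `S` is holomorphic in the open right half-plane: it extends to a family of
weak* continuous operators `S_z`, `Re z > 0`, which has the semigroup property, for which
`z ↦ S_z φ` is holomorphic with values in the Banach space `L_∞`, and for which `S_z φ → φ` in the
weak* sense as `z → 0` in each sector `|arg z| ≤ θ` with `θ < π / 2`. -/
def IsHolomorphicRightHalfPlane {μ : Measure ℝ}
    (S : ℝ → WeakStarLinf μ →L[ℂ] WeakStarLinf μ) : Prop :=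
  ∃ Z : ℂ → WeakStarLinf μ →L[ℂ] WeakStarLinf μ,
    (∀ t : ℝ, 0 < t → Z t = S t) ∧
    (∀ z w : ℂ, 0 < z.re → 0 < w.re → Z (z + w) = (Z z).comp (Z w)) ∧
    (∀ φ, DifferentiableOn ℂ (fun z => toLinf (Z z φ)) {z | 0 < z.re}) ∧
    (∀ φ, ∀ θ < Real.pi / 2,
      Tendsto (fun z => Z z φ) (𝓝[{z | z ≠ 0 ∧ |z.arg| ≤ θ}] 0) (𝓝 φ))

end

/-!
The divergence of the two integrals makes `e x = ∫_0^x a⁻¹` a `C^1` diffeomorphism of the line that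
turns `a d/dx` into `d/dx`, and the flow into translation (`exists_isStraightening`). Composition with
`e` identifies `L_∞(ρ dx)` with `L_∞(dx)`, weak* topology included, so the group `T` is a copy of the
translation group (`flowGroup`). Beyond the fact that translations form a weak* continuous group of
contractions, only one property of them is used: by Fubini's theorem they can be averaged against
every `k ∈ L_1`, giving a weak* continuous operator `∫ k(s) T_s ds` of norm at most `‖k‖₁`. These
properties are collected in `IsAveragingGroup`, and the rest of the operator theory is done for such
groups.

Write `A` for the generator of `T` with the convention `T_t = e^{-tA}`. Averaging against
`e^{-s} 1_{s>0}` gives the inverse of `1 + A`, and together with its mirror image the inverse of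
`1 - A² = (1 - A)(1 + A)`. Hence `A` and `A²` are weak* closed, and a restriction of `A` or `-A²` is
a core as soon as its range, after adding `1`, is weak* dense. For a `T`-invariant restriction with
dense domain this holds: if `ψ ∈ L_1` annihilates the range, then `m(t) = ⟨T_t φ, ψ⟩` is a bounded
solution of `m' = m`, respectively `m'' = m`, so `m = 0`. This applies to `X_max` and `H_max`, whose
domains are mapped to themselves by the flow and contain all `v ∘ e` with `v` a test function. The
smaller operators `X_min` and `H_min` have the same closures by mollification.

Averaging against the heat kernel at complex time `z` gives `S_z = e^{zA²}`. The semigroup law is the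
convolution identity of the kernels, holomorphy in norm follows from the second-order remainder of
the exponential in `L_1`, and the limits at `0` follow by parabolic scaling and dominated convergence.
A Taylor expansion of the orbits shows that `-A²` is contained in the generator of `S`; the two
agree because `1 - A²` is onto while `1` plus the generator of a contraction semigroup is injective.
-/

noncomputable section

/-! ### The weak* duality between `L_∞` and `L_1` -/

section Duality

variable {μ : Measure ℝ}

/-- The weak* continuous functional `φ ↦ ∫ φ ψ dμ` on `L_∞(μ)` given by `ψ ∈ L_1(μ)`. -/
def evalAt (ψ : Lp ℂ 1 μ) : WeakStarLinf μ →L[ℂ] ℂ := WeakBilin.eval (linfPairing μ) ψ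

theorem evalAt_apply (ψ : Lp ℂ 1 μ) (φ : WeakStarLinf μ) :
    evalAt ψ φ = ∫ x, toLinf φ x * ψ x ∂μ :=
  linfPairing_apply μ (toLinf φ) ψ

theorem ae_norm_le_norm (φ : Lp ℂ ∞ μ) : ∀ᵐ x ∂μ, ‖φ x‖ ≤ ‖φ‖ := by
  filter_upwards [ae_le_eLpNormEssSup (f := φ) (μ := μ)] with x hx
  rw [Lp.norm_def, ← toReal_enorm]
  exact ENNReal.toReal_mono (Lp.eLpNorm_ne_top φ) (by rwa [eLpNorm_exponent_top])

theorem norm_le_of_ae_norm_le (φ : Lp ℂ ∞ μ) {C : ℝ} (hC : 0 ≤ C) (h : ∀ᵐ x ∂μ, ‖φ x‖ ≤ C) :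
    ‖φ‖ ≤ C := by
  rw [Lp.norm_def, eLpNorm_exponent_top]
  refine ENNReal.toReal_le_of_le_ofReal hC (eLpNormEssSup_le_of_ae_bound h)

theorem norm_evalAt_le (ψ : Lp ℂ 1 μ) (φ : WeakStarLinf μ) :
    ‖evalAt ψ φ‖ ≤ ‖toLinf φ‖ * ‖ψ‖ := by
  rw [evalAt_apply]
  have hb : ∀ᵐ x ∂μ, ‖toLinf φ x‖ ≤ ‖toLinf φ‖ := ae_norm_le_norm _
  have hψ : Integrable ψ μ := L1.integrable_coeFn ψ
  calc ‖∫ x, toLinf φ x * ψ x ∂μ‖ ≤ ∫ x, ‖toLinf φ‖ * ‖ψ x‖ ∂μ := by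
        refine norm_integral_le_of_norm_le (hψ.norm.const_mul _) ?_
        filter_upwards [hb] with x hx
        rw [norm_mul]
        gcongr
    _ = ‖toLinf φ‖ * ‖ψ‖ := by rw [integral_const_mul, L1.norm_eq_integral_norm]

theorem evalAt_indicator (φ : WeakStarLinf μ) {s : Set ℝ} (hs : MeasurableSet s) (hμs : μ s ≠ ⊤) :
    evalAt (indicatorConstLp 1 hs hμs (1 : ℂ)) φ = ∫ x in s, toLinf φ x ∂μ := by
  rw [evalAt_apply, ← integral_indicator hs]
  refine integral_congr_ae ?_
  filter_upwards [indicatorConstLp_coeFn (p := 1) (hs := hs) (hμs := hμs) (c := (1 : ℂ))]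
    with x hx
  rw [hx]
  by_cases hxs : x ∈ s <;> simp [hxs]

theorem eq_zero_of_evalAt [SigmaFinite μ] {φ : WeakStarLinf μ}
    (h : ∀ ψ : Lp ℂ 1 μ, evalAt ψ φ = 0) : φ = 0 := by
  suffices toLinf φ = 0 from toLinf.map_eq_zero_iff.1 this
  rw [Lp.eq_zero_iff_ae_eq_zero]
  have hb : ∀ᵐ x ∂μ, ‖toLinf φ x‖ ≤ ‖toLinf φ‖ := ae_norm_le_norm _
  refine ae_eq_zero_of_forall_setIntegral_eq_of_sigmaFinite ?_ ?_
  · intro s hs hμs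
    refine Measure.integrableOn_of_bounded hμs.ne (Lp.aestronglyMeasurable _)
      (M := ‖toLinf φ‖) (ae_restrict_of_ae hb)
  · intro s hs hμs
    have h1 := h (indicatorConstLp 1 hs hμs.ne (1 : ℂ))
    rwa [evalAt_indicator] at h1

theorem weakStar_ext [SigmaFinite μ] {φ φ' : WeakStarLinf μ}
    (h : ∀ ψ : Lp ℂ 1 μ, evalAt ψ φ = evalAt ψ φ') : φ = φ' :=
  sub_eq_zero.1 (eq_zero_of_evalAt fun ψ => by rw [map_sub, h, sub_self])

theorem linfPairing_injective [SigmaFinite μ] : Function.Injective (linfPairing μ) := by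
  intro φ φ' h
  refine weakStar_ext (μ := μ) (φ := φ) (φ' := φ') fun ψ => ?_
  exact congrArg (fun L => L ψ) h

instance [SigmaFinite μ] : T2Space (WeakStarLinf μ) :=
  (WeakBilin.isEmbedding linfPairing_injective).t2Space

theorem tendsto_weakStar [SigmaFinite μ] {ι : Type*} {l : Filter ι} {f : ι → WeakStarLinf μ}
    {φ : WeakStarLinf μ} :
    Tendsto f l (𝓝 φ) ↔ ∀ ψ : Lp ℂ 1 μ, Tendsto (fun i => evalAt ψ (f i)) l (𝓝 (evalAt ψ φ)) :=
  WeakBilin.tendsto_iff_forall_eval_tendsto (linfPairing μ) linfPairing_injective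

theorem continuous_weakStar {X : Type*} [TopologicalSpace X] {f : X → WeakStarLinf μ}
    (h : ∀ ψ : Lp ℂ 1 μ, Continuous fun x => evalAt ψ (f x)) : Continuous f :=
  WeakBilin.continuous_of_continuous_eval _ h

/-- A linear map that has a pre-adjoint on `L_1` is weak* continuous. -/
def weakStarMapOfAdjoint {ν : Measure ℝ} (A : WeakStarLinf μ →ₗ[ℂ] WeakStarLinf ν)
    (h : ∀ ψ : Lp ℂ 1 ν, ∃ ψ' : Lp ℂ 1 μ, ∀ φ, evalAt ψ (A φ) = evalAt ψ' φ) :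
    WeakStarLinf μ →L[ℂ] WeakStarLinf ν where
  toLinearMap := A
  cont := continuous_weakStar fun ψ => by
    obtain ⟨ψ', hψ'⟩ := h ψ
    exact (evalAt ψ').continuous.congr fun φ => (hψ' φ).symm

/-- Hahn–Banach: a subspace of `L_∞` with trivial annihilator in `L_1` is weak* dense. -/
theorem dense_of_annihilator_eq_zero {W : Submodule ℂ (WeakStarLinf μ)}
    (h : ∀ ψ : Lp ℂ 1 μ, (∀ φ ∈ W, evalAt ψ φ = 0) → ψ = 0) :
    Dense (W : Set (WeakStarLinf μ)) := by
  rw [Submodule.dense_iff_topologicalClosure_eq_top, Submodule.eq_top_iff']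
  intro φ
  by_contra hφ
  have hconv : Convex ℝ (W.topologicalClosure : Set (WeakStarLinf μ)) :=
    (W.topologicalClosure.restrictScalars ℝ).convex
  obtain ⟨f, u, hf, hu⟩ := RCLike.geometric_hahn_banach_closed_point (𝕜 := ℂ) hconv
    W.isClosed_topologicalClosure hφ
  obtain ⟨ψ, rfl⟩ := LinearMap.dualEmbedding_surjective (linfPairing μ) f
  have h0 : 0 < u := by simpa using hf 0 (Submodule.zero_mem _)
  -- a functional with bounded real part on a subspace vanishes there
  have hann : ∀ w ∈ W, evalAt ψ w = 0 := by
    intro w hw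
    have hre : ∀ c : ℂ, (c * evalAt ψ w).re < u := by
      intro c
      have := hf (c • w) (W.le_topologicalClosure (W.smul_mem c hw))
      rwa [show (WeakBilin.eval (linfPairing μ)) ψ = evalAt ψ from rfl, map_smul, smul_eq_mul] at this
    by_contra hne
    have := hre ((u : ℂ) / evalAt ψ w)
    rw [div_mul_cancel₀ _ hne, Complex.ofReal_re] at this
    exact lt_irrefl _ this
  rw [h ψ hann, map_zero] at hu
  simp at hu
  exact absurd hu h0.not_gt

/-- Dominated convergence: bounded pointwise convergence implies weak* convergence. -/
theorem tendsto_weakStar_of_bounded [SigmaFinite μ] {ι : Type*} {l : Filter ι}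
    [l.IsCountablyGenerated] {f : ι → WeakStarLinf μ} {φ : WeakStarLinf μ} {u : ι → ℝ → ℂ}
    {v : ℝ → ℂ} (hf : ∀ i, toLinf (f i) =ᵐ[μ] u i) (hφ : toLinf φ =ᵐ[μ] v) (C : ℝ)
    (hC : ∀ᶠ i in l, ∀ x, ‖u i x‖ ≤ C) (h : ∀ x, Tendsto (fun i => u i x) l (𝓝 (v x))) :
    Tendsto f l (𝓝 φ) := by
  rw [tendsto_weakStar]
  intro ψ
  have hψ : Integrable ψ μ := L1.integrable_coeFn ψ
  have e1 : ∀ i, evalAt ψ (f i) = ∫ x, u i x * ψ x ∂μ := fun i => by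
    rw [evalAt_apply]
    refine integral_congr_ae ?_
    filter_upwards [hf i] with x hx
    rw [hx]
  have e2 : evalAt ψ φ = ∫ x, v x * ψ x ∂μ := by
    rw [evalAt_apply]
    refine integral_congr_ae ?_
    filter_upwards [hφ] with x hx
    rw [hx]
  simp_rw [e1, e2]
  refine tendsto_integral_filter_of_dominated_convergence (fun x => C * ‖ψ x‖) ?_ ?_
    (hψ.norm.const_mul C) ?_
  · refine Eventually.of_forall fun i => AEStronglyMeasurable.mul ?_ hψ.aestronglyMeasurable
    exact (Lp.aestronglyMeasurable (toLinf (f i))).congr (hf i)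
  · filter_upwards [hC] with i hi
    refine ae_of_all _ fun x => ?_
    rw [norm_mul]
    exact mul_le_mul_of_nonneg_right (hi x) (norm_nonneg _)
  · exact ae_of_all _ fun x => (h x).mul_const _

end Duality

/-! ### Generators of weak* continuous semigroups and groups -/

section Generators

variable {μ : Measure ℝ}

/-- The graph of the weak* generator of `S`, with the sign convention `S_t = e^{-tA}`. -/
def generatorGraph (S : ℝ → WeakStarLinf μ →L[ℂ] WeakStarLinf μ) :
    Submodule ℂ (WeakStarLinf μ × WeakStarLinf μ) where
  carrier := {p | Tendsto (fun t : ℝ => ((t : ℂ)⁻¹) • (p.1 - S t p.1)) (𝓝[>] 0) (𝓝 p.2)}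
  zero_mem' := by simpa using tendsto_const_nhds
  add_mem' := by
    rintro p q hp hq
    refine (hp.add hq).congr fun t => ?_
    rw [← smul_add, Prod.fst_add, map_add]
    congr 1
    abel
  smul_mem' := by
    rintro c p hp
    refine (hp.const_smul c).congr fun t => ?_
    rw [smul_comm, Prod.smul_fst, map_smul, smul_sub]

theorem mem_generatorGraph {S : ℝ → WeakStarLinf μ →L[ℂ] WeakStarLinf μ}
    {p : WeakStarLinf μ × WeakStarLinf μ} : p ∈ generatorGraph S ↔
      Tendsto (fun t : ℝ => ((t : ℂ)⁻¹) • (p.1 - S t p.1)) (𝓝[>] 0) (𝓝 p.2) := Iff.rfl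

/-- The scalar form of the definition of the generator: the orbit seen through any weak*
continuous functional has a right derivative at `0`. -/
theorem hasDerivWithinAt_of_mem_generatorGraph {S : ℝ → WeakStarLinf μ →L[ℂ] WeakStarLinf μ}
    (h0 : S 0 = ContinuousLinearMap.id ℂ _) {φ η : WeakStarLinf μ}
    (h : (φ, η) ∈ generatorGraph S) (ℓ : WeakStarLinf μ →L[ℂ] ℂ) :
    HasDerivWithinAt (fun t => ℓ (S t φ)) (-ℓ η) (Set.Ioi 0) 0 := by
  rw [hasDerivWithinAt_iff_tendsto_slope' (by simp)]
  refine (((ℓ.continuous.tendsto η).comp h).neg).congr fun t => ?_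
  simp only [Function.comp, slope, vsub_eq_sub, sub_zero, h0, map_smul, map_sub,
    ContinuousLinearMap.id_apply, smul_eq_mul, Complex.real_smul, Complex.ofReal_inv]
  ring

theorem mem_generatorGraph_of_hasDerivWithinAt [SigmaFinite μ]
    {S : ℝ → WeakStarLinf μ →L[ℂ] WeakStarLinf μ}
    (h0 : S 0 = ContinuousLinearMap.id ℂ _) {φ η : WeakStarLinf μ}
    (h : ∀ ψ, HasDerivWithinAt (fun t => evalAt ψ (S t φ)) (-evalAt ψ η) (Set.Ioi 0) 0) :
    (φ, η) ∈ generatorGraph S := by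
  rw [mem_generatorGraph, tendsto_weakStar]
  intro ψ
  have := (hasDerivWithinAt_iff_tendsto_slope' (by simp)).1 (h ψ)
  have := this.neg
  rw [neg_neg] at this
  refine this.congr fun t => ?_
  simp only [slope, vsub_eq_sub, sub_zero, h0, map_smul, map_sub,
    ContinuousLinearMap.id_apply, smul_eq_mul, Complex.real_smul, Complex.ofReal_inv]
  ring

theorem generatorGraph_unique [SigmaFinite μ] {S : ℝ → WeakStarLinf μ →L[ℂ] WeakStarLinf μ}
    {φ η η' : WeakStarLinf μ} (h : (φ, η) ∈ generatorGraph S) (h' : (φ, η') ∈ generatorGraph S) :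
    η = η' :=
  tendsto_nhds_unique (mem_generatorGraph.1 h) (mem_generatorGraph.1 h')

/-- If `A` generates a contractive semigroup then `1 + A` is injective: a solution of `A δ = -δ`
would have the growing orbit `e^t δ`. -/
theorem eq_zero_of_mem_generatorGraph_neg [SigmaFinite μ]
    {S : ℝ → WeakStarLinf μ →L[ℂ] WeakStarLinf μ} (hS : IsWeakStarSemigroup S)
    (hc : IsContractiveFamily S) {δ : WeakStarLinf μ} (h : (δ, -δ) ∈ generatorGraph S) :
    δ = 0 := by
  refine eq_zero_of_evalAt fun ψ => ?_
  set f : ℝ → ℂ := fun t => Complex.exp (-t) * evalAt ψ (S t δ) with hf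
  have hcont : ∀ T : ℝ, ContinuousOn f (Set.Icc 0 T) := fun T => by
    refine (by fun_prop : Continuous fun t : ℝ => Complex.exp (-t)).continuousOn.mul ?_
    exact (evalAt ψ).continuous.comp_continuousOn
      ((hS.continuousOn δ).mono Set.Icc_subset_Ici_self)
  have hderiv : ∀ t : ℝ, 0 ≤ t → HasDerivWithinAt f 0 (Set.Ici t) t := by
    intro t ht
    have h1 := hasDerivWithinAt_of_mem_generatorGraph hS.zero h ((evalAt ψ).comp (S t))
    have h2 : HasDerivWithinAt (fun r => evalAt ψ (S r δ)) (evalAt ψ (S t δ)) (Set.Ioi t) t := by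
      have h3 := h1.scomp_of_eq (h := fun r : ℝ => r - t) (h' := 1) (s := Set.Ioi t) t
        ((hasDerivAt_id t).sub_const t).hasDerivWithinAt
        (fun r hr => by simpa using hr) (by simp)
      refine (h3.congr_deriv (by simp)).congr (fun r hr => ?_) ?_
      · have : S r = (S t).comp (S (r - t)) := by
          rw [← hS.add t (r - t) ht (sub_nonneg.2 (le_of_lt hr)), add_sub_cancel]
        simp [this, Function.comp]
      · simp [Function.comp, hS.zero]
    have h4 : HasDerivAt (fun r : ℝ => Complex.exp (-r)) (-Complex.exp (-t)) t := by
      have := ((Complex.ofRealCLM.hasDerivAt (x := t)).neg).cexp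
      simpa using this
    have := (h4.hasDerivWithinAt (s := Set.Ioi t)).mul h2
    rw [← hasDerivWithinAt_Ioi_iff_Ici]
    refine this.congr_deriv ?_
    ring
  have hconst : ∀ t : ℝ, 0 ≤ t → f t = evalAt ψ δ := fun t ht => by
    have := constant_of_has_deriv_right_zero (hcont t) (fun x hx => hderiv x hx.1) t ⟨ht, le_rfl⟩
    rw [this]
    simp [hf, hS.zero]
  have hbound : ∀ t : ℝ, 0 ≤ t → ‖evalAt ψ δ‖ ≤ Real.exp (-t) * (‖toLinf δ‖ * ‖ψ‖) := by
    intro t ht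
    rw [← hconst t ht, hf]
    simp only [norm_mul, Complex.norm_exp, Complex.neg_re, Complex.ofReal_re]
    gcongr
    exact (norm_evalAt_le _ _).trans (by gcongr; exact hc t ht δ)
  have hlim : Tendsto (fun t : ℝ => Real.exp (-t) * (‖toLinf δ‖ * ‖ψ‖)) atTop (𝓝 0) := by
    simpa using Real.tendsto_exp_neg_atTop_nhds_zero.mul_const (‖toLinf δ‖ * ‖ψ‖)
  have : ‖evalAt ψ δ‖ ≤ 0 :=
    ge_of_tendsto hlim ((eventually_ge_atTop 0).mono hbound)
  simpa using this

/-- A weak* continuous group of contractions that can be averaged against every integrable kernel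
`k`: there is a weak* continuous operator `∫ k(s) T_s ds`, of norm at most `‖k‖₁`. -/
structure IsAveragingGroup (T : ℝ → WeakStarLinf μ →L[ℂ] WeakStarLinf μ) : Prop
    extends IsWeakStarGroup T where
  norm_le : ∀ t φ, ‖toLinf (T t φ)‖ ≤ ‖toLinf φ‖
  exists_average : ∀ k : ℝ → ℂ, Integrable k → ∃ K : WeakStarLinf μ →L[ℂ] WeakStarLinf μ,
    (∀ φ ψ, evalAt ψ (K φ) = ∫ s, k s * evalAt ψ (T s φ)) ∧
      ∀ φ, ‖toLinf (K φ)‖ ≤ (∫ s, ‖k s‖) * ‖toLinf φ‖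

variable {T : ℝ → WeakStarLinf μ →L[ℂ] WeakStarLinf μ}

open Classical in
/-- The operator `∫ k(s) T_s ds`, understood in the weak* sense; it is `0` if there is no such
operator. -/
def groupAverage (T : ℝ → WeakStarLinf μ →L[ℂ] WeakStarLinf μ) (k : ℝ → ℂ) :
    WeakStarLinf μ →L[ℂ] WeakStarLinf μ :=
  if h : ∃ K : WeakStarLinf μ →L[ℂ] WeakStarLinf μ,
    (∀ φ ψ, evalAt ψ (K φ) = ∫ s, k s * evalAt ψ (T s φ)) ∧
      ∀ φ, ‖toLinf (K φ)‖ ≤ (∫ s, ‖k s‖) * ‖toLinf φ‖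
  then h.choose else 0

namespace IsAveragingGroup

theorem evalAt_groupAverage (hT : IsAveragingGroup T) {k : ℝ → ℂ} (hk : Integrable k)
    (φ : WeakStarLinf μ) (ψ : Lp ℂ 1 μ) :
    evalAt ψ (groupAverage T k φ) = ∫ s, k s * evalAt ψ (T s φ) := by
  rw [groupAverage, dif_pos (hT.exists_average k hk)]
  exact (hT.exists_average k hk).choose_spec.1 φ ψ

theorem norm_groupAverage_le (hT : IsAveragingGroup T) {k : ℝ → ℂ} (hk : Integrable k)
    (φ : WeakStarLinf μ) : ‖toLinf (groupAverage T k φ)‖ ≤ (∫ s, ‖k s‖) * ‖toLinf φ‖ := by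
  rw [groupAverage, dif_pos (hT.exists_average k hk)]
  exact (hT.exists_average k hk).choose_spec.2 φ

theorem continuous_evalAt (hT : IsAveragingGroup T) (φ : WeakStarLinf μ) (ψ : Lp ℂ 1 μ) :
    Continuous fun t => evalAt ψ (T t φ) :=
  (evalAt ψ).continuous.comp (hT.continuous φ)

theorem norm_evalAt_le (hT : IsAveragingGroup T) (φ : WeakStarLinf μ) (ψ : Lp ℂ 1 μ) (t : ℝ) :
    ‖evalAt ψ (T t φ)‖ ≤ ‖toLinf φ‖ * ‖ψ‖ :=
  (_root_.norm_evalAt_le _ _).trans (by gcongr; exact hT.norm_le t φ)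

theorem integrable_mul_evalAt (hT : IsAveragingGroup T) {k : ℝ → ℂ} (hk : Integrable k)
    (φ : WeakStarLinf μ) (ψ : Lp ℂ 1 μ) : Integrable fun s => k s * evalAt ψ (T s φ) :=
  hk.mul_bdd (hT.continuous_evalAt φ ψ).aestronglyMeasurable
    (ae_of_all _ (hT.norm_evalAt_le φ ψ))

theorem isWeakStarSemigroup (hT : IsAveragingGroup T) : IsWeakStarSemigroup T where
  zero := hT.zero
  add := fun s t _ _ => hT.add s t
  continuousOn := fun φ => (hT.continuous φ).continuousOn

theorem isContractiveFamily (hT : IsAveragingGroup T) : IsContractiveFamily T :=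
  fun t _ φ => hT.norm_le t φ

theorem reverse (hT : IsAveragingGroup T) : IsAveragingGroup fun t => T (-t) where
  zero := by simpa using hT.zero
  add := fun s t => by rw [neg_add]; exact hT.add _ _
  continuous := fun φ => (hT.continuous φ).comp continuous_neg
  norm_le := fun t φ => hT.norm_le _ φ
  exists_average := fun k hk => by
    obtain ⟨K, h1, h2⟩ := hT.exists_average (fun s => k (-s)) hk.comp_neg
    refine ⟨K, fun φ ψ => ?_, fun φ => ?_⟩
    · rw [h1, ← integral_neg_eq_self]
      simp
    · rw [← integral_neg_eq_self (fun s => ‖k s‖)]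
      exact h2 φ

theorem hasDerivAt (hT : IsAveragingGroup T) {φ η : WeakStarLinf μ}
    (h : (φ, η) ∈ generatorGraph T) (ψ : Lp ℂ 1 μ) (t : ℝ) :
    HasDerivAt (fun t => evalAt ψ (T t φ)) (-evalAt ψ (T t η)) t := by
  have hr : ∀ t, HasDerivWithinAt (fun t => evalAt ψ (T t φ)) (-evalAt ψ (T t η)) (Set.Ioi t) t := by
    intro t
    have h1 := hasDerivWithinAt_of_mem_generatorGraph hT.zero h ((evalAt ψ).comp (T t))
    have h3 := h1.scomp_of_eq (h := fun r : ℝ => r - t) (h' := 1) (s := Set.Ioi t) t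
      ((hasDerivAt_id t).sub_const t).hasDerivWithinAt
      (fun r hr => by simpa using hr) (by simp)
    have he : ∀ r, evalAt ψ (T r φ) = evalAt ψ (T t (T (r - t) φ)) := fun r => by
      have : T r = (T t).comp (T (r - t)) := by rw [← hT.add, add_sub_cancel]
      rw [this]; rfl
    exact (h3.congr_deriv (by simp)).congr (fun r _ => he r) (he t)
  have hn : Continuous fun t => -evalAt ψ (T t η) := (hT.continuous_evalAt η ψ).neg
  have hi : ∀ t, evalAt ψ (T t φ) = evalAt ψ (T 0 φ) + ∫ s in (0 : ℝ)..t, -evalAt ψ (T s η) := by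
    intro t
    rw [intervalIntegral.integral_eq_sub_of_hasDeriv_right
      (hT.continuous_evalAt φ ψ).continuousOn (fun x _ => hr x) (hn.intervalIntegrable _ _)]
    ring
  rw [funext hi]
  exact (hn.integral_hasStrictDerivAt 0 t).hasDerivAt.const_add _

theorem mem_generatorGraph_reverse [SigmaFinite μ] (hT : IsAveragingGroup T) {φ η : WeakStarLinf μ}
    (h : (φ, η) ∈ generatorGraph T) : (φ, -η) ∈ generatorGraph fun t => T (-t) := by
  refine mem_generatorGraph_of_hasDerivWithinAt hT.reverse.zero fun ψ => ?_
  have h1 := (hT.hasDerivAt h ψ (-0)).scomp (0 : ℝ) (hasDerivAt_neg (0 : ℝ))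
  have h0 : T 0 η = η := by rw [hT.zero]; rfl
  refine HasDerivAt.hasDerivWithinAt (h1.congr_deriv ?_)
  simp [h0]

theorem mem_generatorGraph_of_reverse [SigmaFinite μ] (hT : IsAveragingGroup T)
    {φ η : WeakStarLinf μ} (h : (φ, η) ∈ generatorGraph fun t => T (-t)) :
    (φ, -η) ∈ generatorGraph T := by
  simpa using hT.reverse.mem_generatorGraph_reverse h

theorem evalAt_comp (ψ : Lp ℂ 1 μ) (A : WeakStarLinf μ →L[ℂ] WeakStarLinf μ) :
    ∃ ψ' : Lp ℂ 1 μ, ∀ φ, evalAt ψ (A φ) = evalAt ψ' φ := by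
  obtain ⟨ψ', h⟩ := LinearMap.dualEmbedding_surjective (linfPairing μ) ((evalAt ψ).comp A)
  exact ⟨ψ', fun φ => (congrArg (fun L => L φ) h).symm⟩

end IsAveragingGroup

/-! ### The resolvent of a group -/

/-- The kernel `s ↦ e^{-s}` on the positive half-line. -/
def expKernel (s : ℝ) : ℂ := Set.indicator (Set.Ioi 0) (fun s : ℝ => ((Real.exp (-s) : ℝ) : ℂ)) s

theorem integrable_expKernel : Integrable expKernel := by
  unfold expKernel
  rw [integrable_indicator_iff measurableSet_Ioi]
  have := (integrableOn_exp_neg_Ioi 0).ofReal (𝕜 := ℂ)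
  exact this

/-- The operator `∫_0^∞ e^{-s} T_s ds`, which is `(1 + A)⁻¹` if `A` generates `T`. -/
def groupResolvent (T : ℝ → WeakStarLinf μ →L[ℂ] WeakStarLinf μ) :
    WeakStarLinf μ →L[ℂ] WeakStarLinf μ := groupAverage T expKernel

namespace IsAveragingGroup

theorem evalAt_groupResolvent (hT : IsAveragingGroup T) (φ : WeakStarLinf μ) (ψ : Lp ℂ 1 μ) :
    evalAt ψ (groupResolvent T φ) =
      ∫ s in Set.Ioi (0 : ℝ), ((Real.exp (-s) : ℝ) : ℂ) * evalAt ψ (T s φ) := by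
  rw [groupResolvent, hT.evalAt_groupAverage integrable_expKernel, ← integral_indicator measurableSet_Ioi]
  refine integral_congr_ae (ae_of_all _ fun s => ?_)
  simp only [expKernel, Set.indicator_mul_left]

theorem groupResolvent_mem [SigmaFinite μ] (hT : IsAveragingGroup T) (φ : WeakStarLinf μ) :
    (groupResolvent T φ, φ - groupResolvent T φ) ∈ generatorGraph T := by
  refine mem_generatorGraph_of_hasDerivWithinAt hT.zero fun ψ => ?_
  set g : ℝ → ℂ := fun s => ((Real.exp (-s) : ℝ) : ℂ) * evalAt ψ (T s φ) with hg
  have hgc : Continuous g :=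
    (Complex.continuous_ofReal.comp (Real.continuous_exp.comp continuous_neg)).mul
      (hT.continuous_evalAt φ ψ)
  have hgi : ∀ t, IntegrableOn g (Set.Ioi t) := by
    intro t
    refine Integrable.mul_bdd (c := ‖toLinf φ‖ * ‖ψ‖) ?_
      (hT.continuous_evalAt φ ψ).aestronglyMeasurable (ae_of_all _ (hT.norm_evalAt_le φ ψ))
    exact (integrableOn_exp_neg_Ioi t).ofReal (𝕜 := ℂ)
  have hy : ∀ t, evalAt ψ (T t (groupResolvent T φ)) =
      ((Real.exp t : ℝ) : ℂ) * (evalAt ψ (groupResolvent T φ) - ∫ s in (0 : ℝ)..t, g s) := by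
    intro t
    obtain ⟨ψ', hψ'⟩ := evalAt_comp ψ (T t)
    have e1 : evalAt ψ (T t (groupResolvent T φ)) =
        ∫ s in Set.Ioi (0 : ℝ), ((Real.exp t : ℝ) : ℂ) * g (s + t) := by
      rw [hψ', hT.evalAt_groupResolvent]
      refine setIntegral_congr_fun measurableSet_Ioi fun s _ => ?_
      have : T (s + t) = (T t).comp (T s) := by rw [add_comm, hT.add]
      simp only [hg, this, ContinuousLinearMap.comp_apply, hψ']
      rw [← mul_assoc, ← Complex.ofReal_mul, ← Real.exp_add]
      congr 3
      ring_nf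
    have e2 : ∫ s in Set.Ioi (0 : ℝ), g (s + t) = ∫ s in Set.Ioi t, g s := by
      have := (measurePreserving_add_right volume t).setIntegral_preimage_emb
        (measurableEmbedding_addRight t) g (Set.Ioi t)
      simpa using this
    have e3 : (∫ s in Set.Ioi (0 : ℝ), g s) - ∫ s in Set.Ioi t, g s = ∫ s in (0 : ℝ)..t, g s :=
      intervalIntegral.integral_Ioi_sub_Ioi' (hgi 0) (hgi t)
    rw [e1, integral_const_mul, e2, ← e3, hT.evalAt_groupResolvent]
    ring
  rw [funext hy]
  have d1 : HasDerivAt (fun t : ℝ => ((Real.exp t : ℝ) : ℂ)) ((Real.exp 0 : ℝ) : ℂ) 0 :=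
    (Real.hasDerivAt_exp 0).ofReal_comp
  have d2 := ((hgc.integral_hasStrictDerivAt 0 0).hasDerivAt).const_sub (evalAt ψ (groupResolvent T φ))
  have h0 : T 0 φ = φ := by rw [hT.zero]; rfl
  refine HasDerivAt.hasDerivWithinAt ((d1.mul d2).congr_deriv ?_)
  simp [hg, h0]
  ring

/-- The operator `1 + A` is a bijection onto `L_∞` with inverse `∫_0^∞ e^{-s} T_s ds`. -/
theorem mem_generatorGraph_iff [SigmaFinite μ] (hT : IsAveragingGroup T) {φ η : WeakStarLinf μ} :
    (φ, η) ∈ generatorGraph T ↔ groupResolvent T (φ + η) = φ := by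
  constructor
  · intro h
    have h1 := hT.groupResolvent_mem (φ + η)
    have h2 := (generatorGraph T).sub_mem h1 h
    rw [← sub_eq_zero]
    refine eq_zero_of_mem_generatorGraph_neg hT.isWeakStarSemigroup hT.isContractiveFamily ?_
    convert h2 using 1
    ext1 <;> simp; abel
  · intro h
    have := hT.groupResolvent_mem (φ + η)
    rwa [h, add_sub_cancel_left] at this

end IsAveragingGroup

end Generators

/-! ### Cores -/

section Cores

theorem eq_zero_of_bounded_of_hasDerivAt_self {m : ℝ → ℂ} {C : ℝ} (hb : ∀ t, ‖m t‖ ≤ C)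
    (h : ∀ t, HasDerivAt m (m t) t) (t : ℝ) : m t = 0 := by
  set f : ℝ → ℂ := fun s => ((Real.exp (-s) : ℝ) : ℂ) * m s with hf
  have hd : ∀ s, HasDerivAt f 0 s := fun s => by
    have h1 : HasDerivAt (fun s : ℝ => ((Real.exp (-s) : ℝ) : ℂ)) (-(Real.exp (-s) : ℝ) : ℂ) s := by
      have := ((hasDerivAt_neg s).exp).ofReal_comp
      simpa using this
    refine (h1.mul (h s)).congr_deriv ?_
    ring
  have hconst : ∀ s, f t = f s := fun s =>
    is_const_of_deriv_eq_zero (fun s => (hd s).differentiableAt) (fun s => (hd s).deriv) t s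
  have hle : ∀ s, ‖f t‖ ≤ Real.exp (-s) * C := fun s => by
    rw [hconst s, hf]
    simp only [norm_mul, Complex.norm_real, Real.norm_eq_abs, Real.abs_exp]
    gcongr
    exact hb s
  have hlim : Tendsto (fun s : ℝ => Real.exp (-s) * C) atTop (𝓝 0) := by
    simpa using Real.tendsto_exp_neg_atTop_nhds_zero.mul_const C
  have h0 : ‖f t‖ ≤ 0 := ge_of_tendsto' hlim hle
  have h1 : f t = 0 := by simpa using h0
  rw [hf] at h1
  simpa [(Real.exp_pos (-t)).ne'] using h1

theorem eq_zero_of_bounded_of_hasDerivAt_neg {m : ℝ → ℂ} {C : ℝ} (hb : ∀ t, ‖m t‖ ≤ C)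
    (h : ∀ t, HasDerivAt m (-m t) t) (t : ℝ) : m t = 0 := by
  have := eq_zero_of_bounded_of_hasDerivAt_self (m := fun s => m (-s)) (fun s => hb (-s))
    (fun s => ((h (-s)).scomp s (hasDerivAt_neg s)).congr_deriv (by simp)) (-t)
  simpa using this

/-- The equation `m'' = m` has no nonzero solution that is bounded together with `m'`. -/
theorem eq_zero_of_bounded_of_hasDerivAt_twice {m n : ℝ → ℂ} {C C' : ℝ} (hm : ∀ t, ‖m t‖ ≤ C)
    (hn : ∀ t, ‖n t‖ ≤ C') (h : ∀ t, HasDerivAt m (n t) t) (h' : ∀ t, HasDerivAt n (m t) t)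
    (t : ℝ) : m t = 0 := by
  have h1 := eq_zero_of_bounded_of_hasDerivAt_self (m := fun s => m s + n s) (C := C + C')
    (fun s => (norm_add_le _ _).trans (add_le_add (hm s) (hn s)))
    (fun s => ((h s).add (h' s)).congr_deriv (add_comm _ _)) t
  have h2 := eq_zero_of_bounded_of_hasDerivAt_neg (m := fun s => m s - n s) (C := C + C')
    (fun s => (norm_sub_le _ _).trans (add_le_add (hm s) (hn s)))
    (fun s => ((h s).sub (h' s)).congr_deriv (neg_sub _ _).symm) t
  linear_combination (h1 + h2) / 2

variable {μ : Measure ℝ} {T : ℝ → WeakStarLinf μ →L[ℂ] WeakStarLinf μ}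

/-- The subspace `{φ + η | (φ, η) ∈ D}`, i.e. the range of `1 + A` when `D` is the graph of `A`. -/
def rangeOneAdd (D : Submodule ℂ (WeakStarLinf μ × WeakStarLinf μ)) :
    Submodule ℂ (WeakStarLinf μ) :=
  D.map (LinearMap.fst ℂ _ _ + LinearMap.snd ℂ _ _)

theorem mem_rangeOneAdd {D : Submodule ℂ (WeakStarLinf μ × WeakStarLinf μ)}
    {p : WeakStarLinf μ × WeakStarLinf μ} (hp : p ∈ D) : p.1 + p.2 ∈ rangeOneAdd D :=
  ⟨p, hp, rfl⟩

/-- If `1 + A` has the everywhere defined continuous inverse `R`, then every restriction of `A` for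
which the range of `1 + A` remains dense has closure `A`. -/
theorem topologicalClosure_eq_of_dense_range [SigmaFinite μ]
    {D G : Submodule ℂ (WeakStarLinf μ × WeakStarLinf μ)}
    (R : WeakStarLinf μ →L[ℂ] WeakStarLinf μ) (hG : ∀ p, p ∈ G ↔ R (p.1 + p.2) = p.1)
    (hD : D ≤ G) (hd : Dense (rangeOneAdd D : Set (WeakStarLinf μ))) :
    D.topologicalClosure = G := by
  refine le_antisymm (D.topologicalClosure_minimal hD ?_) fun p hp => ?_
  · have : (G : Set (WeakStarLinf μ × WeakStarLinf μ)) = {p | R (p.1 + p.2) = p.1} :=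
      Set.ext hG
    rw [this]
    exact isClosed_eq (R.continuous.comp (continuous_fst.add continuous_snd)) continuous_fst
  · have hc : Continuous fun f : WeakStarLinf μ => (R f, f - R f) :=
      R.continuous.prodMk (continuous_id.sub R.continuous)
    have h1 : (R (p.1 + p.2), p.1 + p.2 - R (p.1 + p.2)) ∈
        closure (D : Set (WeakStarLinf μ × WeakStarLinf μ)) := by
      refine map_mem_closure (f := fun f : WeakStarLinf μ => (R f, f - R f)) hc (hd (p.1 + p.2)) ?_
      rintro f ⟨q, hq, rfl⟩
      have hq' := (hG q).1 (hD hq)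
      change (R (q.1 + q.2), q.1 + q.2 - R (q.1 + q.2)) ∈ D
      rw [hq', add_sub_cancel_left]
      exact hq
    rw [(hG p).1 hp, add_sub_cancel_left] at h1
    exact h1

/-- The graph of `-A²`, where `A` is the generator of `T`. -/
def negSqGraph (T : ℝ → WeakStarLinf μ →L[ℂ] WeakStarLinf μ) :
    Submodule ℂ (WeakStarLinf μ × WeakStarLinf μ) where
  carrier := {p | ∃ ξ, (p.1, ξ) ∈ generatorGraph T ∧ (ξ, -p.2) ∈ generatorGraph T}
  zero_mem' := ⟨0, (generatorGraph T).zero_mem, by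
    rw [Prod.snd_zero, neg_zero]; exact (generatorGraph T).zero_mem⟩
  add_mem' := by
    rintro p q ⟨ξ, h1, h2⟩ ⟨ζ, h3, h4⟩
    refine ⟨ξ + ζ, (generatorGraph T).add_mem h1 h3, ?_⟩
    have := (generatorGraph T).add_mem h2 h4
    rwa [Prod.mk_add_mk, ← neg_add] at this
  smul_mem' := by
    rintro c p ⟨ξ, h1, h2⟩
    refine ⟨c • ξ, (generatorGraph T).smul_mem c h1, ?_⟩
    have := (generatorGraph T).smul_mem c h2
    rwa [Prod.smul_mk, smul_neg] at this

namespace IsAveragingGroup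

/-- A `T`-invariant part of the graph of the generator with weak* dense domain is a core. -/
theorem topologicalClosure_eq_generatorGraph [SigmaFinite μ] (hT : IsAveragingGroup T)
    {D : Submodule ℂ (WeakStarLinf μ × WeakStarLinf μ)} (hD : D ≤ generatorGraph T)
    (hinv : ∀ t, ∀ p ∈ D, (T t p.1, T t p.2) ∈ D)
    (htot : ∀ ψ, (∀ p ∈ D, evalAt ψ p.1 = 0) → ψ = 0) :
    D.topologicalClosure = generatorGraph T := by
  refine topologicalClosure_eq_of_dense_range (groupResolvent T)
    (fun p => hT.mem_generatorGraph_iff) hD ?_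
  refine dense_of_annihilator_eq_zero fun ψ hψ => htot ψ fun p hp => ?_
  -- along the orbit of `p`, the functional `ψ` solves `m' = m`
  have h := eq_zero_of_bounded_of_hasDerivAt_self (hT.norm_evalAt_le p.1 ψ) (fun t => by
    refine (hT.hasDerivAt (hD hp) ψ t).congr_deriv ?_
    have := hψ _ (mem_rangeOneAdd (hinv t p hp))
    rw [map_add] at this
    linear_combination -this) 0
  rwa [hT.zero] at h

/-- The factorization `1 - A² = (1 - A)(1 + A)` gives the inverse of `1 - A²`. -/
theorem mem_negSqGraph_iff [SigmaFinite μ] (hT : IsAveragingGroup T)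
    {p : WeakStarLinf μ × WeakStarLinf μ} : p ∈ negSqGraph T ↔
      groupResolvent T (groupResolvent (fun t => T (-t)) (p.1 + p.2)) = p.1 := by
  constructor
  · rintro ⟨ξ, h1, h2⟩
    have h3 : (p.1 + ξ, ξ - p.2) ∈ generatorGraph T := by
      have := (generatorGraph T).add_mem h1 h2
      rwa [Prod.mk_add_mk, ← sub_eq_add_neg] at this
    have h4 := hT.reverse.mem_generatorGraph_iff.1 (hT.mem_generatorGraph_reverse h3)
    rw [show p.1 + ξ + -(ξ - p.2) = p.1 + p.2 by abel] at h4
    rw [h4]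
    exact hT.mem_generatorGraph_iff.1 h1
  · intro h
    set f := p.1 + p.2 with hf
    set χ := groupResolvent (fun t => T (-t)) f
    have h1 := hT.groupResolvent_mem χ
    rw [h] at h1
    have h2 := hT.mem_generatorGraph_of_reverse (hT.reverse.groupResolvent_mem f)
    refine ⟨χ - p.1, h1, ?_⟩
    have h3 := (generatorGraph T).sub_mem h2 h1
    rw [Prod.mk_sub_mk] at h3
    convert h3 using 2
    rw [hf]
    abel

/-- A `T`-invariant part of the graph of `-A²` with weak* dense domain is a core. -/
theorem topologicalClosure_eq_negSqGraph [SigmaFinite μ] (hT : IsAveragingGroup T)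
    {D : Submodule ℂ (WeakStarLinf μ × WeakStarLinf μ)} (hD : D ≤ negSqGraph T)
    (hinv : ∀ t, ∀ p ∈ D, (T t p.1, T t p.2) ∈ D)
    (htot : ∀ ψ, (∀ p ∈ D, evalAt ψ p.1 = 0) → ψ = 0) :
    D.topologicalClosure = negSqGraph T := by
  refine topologicalClosure_eq_of_dense_range
    ((groupResolvent T).comp (groupResolvent fun t => T (-t)))
    (fun p => hT.mem_negSqGraph_iff) hD ?_
  refine dense_of_annihilator_eq_zero fun ψ hψ => htot ψ fun p hp => ?_
  obtain ⟨ξ, h1, h2⟩ := hD hp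
  -- along the orbit of `p`, the functional `ψ` solves `m'' = m`
  have h := eq_zero_of_bounded_of_hasDerivAt_twice (hT.norm_evalAt_le p.1 ψ)
    (n := fun t => -evalAt ψ (T t ξ)) (fun t => by
      rw [norm_neg]; exact hT.norm_evalAt_le ξ ψ t)
    (hT.hasDerivAt h1 ψ) (fun t => by
      refine (hT.hasDerivAt h2 ψ t).neg.congr_deriv ?_
      have := hψ _ (mem_rangeOneAdd (hinv t p hp))
      rw [map_add] at this
      rw [map_neg, map_neg]
      linear_combination -this) 0
  rwa [hT.zero] at h

theorem negSqGraph_unique [SigmaFinite μ] {p : WeakStarLinf μ × WeakStarLinf μ}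
    (h : p ∈ negSqGraph T) (h0 : p.1 = 0) : p.2 = 0 := by
  obtain ⟨ξ, h1, h2⟩ := h
  have hz := (generatorGraph T).zero_mem
  rw [h0] at h1
  have : ξ = 0 := generatorGraph_unique h1 hz
  rw [this] at h2
  simpa using generatorGraph_unique h2 hz

end IsAveragingGroup

end Cores

/-! ### The complex heat kernel -/

section HeatKernel

/-- The heat kernel `(4πz)^{-1/2} e^{-s²/(4z)}` at complex time `z`. -/
def heatKernel (z : ℂ) (s : ℝ) : ℂ :=
  ((4 * Real.pi * z) ^ (1 / 2 : ℂ))⁻¹ * Complex.exp (-(4 * z)⁻¹ * (s : ℂ) ^ 2)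

theorem re_inv_four_mul_pos {z : ℂ} (hz : 0 < z.re) : 0 < ((4 * z)⁻¹).re := by
  have h0 : z ≠ 0 := fun h => by simp [h] at hz
  rw [Complex.inv_re]
  refine div_pos (by simpa using hz) (Complex.normSq_pos.2 (by simpa using h0))

theorem ne_zero_of_re_pos {z : ℂ} (hz : 0 < z.re) : z ≠ 0 := fun h => by simp [h] at hz

theorem four_pi_mul_cpow_ne_zero {z : ℂ} (hz : 0 < z.re) :
    (4 * Real.pi * z) ^ (1 / 2 : ℂ) ≠ 0 := by
  rw [Complex.cpow_ne_zero_iff]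
  left
  simpa [Real.pi_ne_zero] using ne_zero_of_re_pos hz

theorem integrable_heatKernel {z : ℂ} (hz : 0 < z.re) : Integrable (heatKernel z) :=
  (integrable_cexp_neg_mul_sq (re_inv_four_mul_pos hz)).const_mul _

theorem integral_cexp_heat {z : ℂ} (hz : 0 < z.re) :
    ∫ s : ℝ, Complex.exp (-(4 * z)⁻¹ * (s : ℂ) ^ 2) = (4 * Real.pi * z) ^ (1 / 2 : ℂ) := by
  rw [integral_gaussian_complex (re_inv_four_mul_pos hz), div_inv_eq_mul]
  congr 1
  ring

theorem integral_heatKernel {z : ℂ} (hz : 0 < z.re) : ∫ s, heatKernel z s = 1 := by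
  unfold heatKernel
  rw [integral_const_mul, integral_cexp_heat hz, inv_mul_cancel₀ (four_pi_mul_cpow_ne_zero hz)]

/-- The semigroup law of the heat kernel. Completing the square gives it up to a constant factor,
which is found by integration, so that no branch of the square root has to be followed. -/
theorem heatKernel_convolution {z w : ℂ} (hz : 0 < z.re) (hw : 0 < w.re) (r : ℝ) :
    ∫ s, heatKernel z s * heatKernel w (r - s) = heatKernel (z + w) r := by
  have hzw : 0 < (z + w).re := by rw [Complex.add_re]; exact add_pos hz hw
  have z0 := ne_zero_of_re_pos hz
  have w0 := ne_zero_of_re_pos hw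
  have zw0 := ne_zero_of_re_pos hzw
  obtain ⟨C, hC⟩ : ∃ C : ℂ, ∀ r : ℝ, ∫ s, heatKernel z s * heatKernel w (r - s) =
      C * heatKernel (z + w) r := by
    set b : ℂ := -((4 * z)⁻¹ + (4 * w)⁻¹) with hb
    have hbre : b.re < 0 := by
      rw [hb, Complex.neg_re, Complex.add_re]
      linarith [re_inv_four_mul_pos hz, re_inv_four_mul_pos hw]
    refine ⟨((4 * Real.pi * z) ^ (1 / 2 : ℂ))⁻¹ * ((4 * Real.pi * w) ^ (1 / 2 : ℂ))⁻¹ *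
      (Real.pi / -b) ^ (1 / 2 : ℂ) * (4 * Real.pi * (z + w)) ^ (1 / 2 : ℂ), fun r => ?_⟩
    have e1 : ∀ s : ℝ, heatKernel z s * heatKernel w (r - s) =
        (((4 * Real.pi * z) ^ (1 / 2 : ℂ))⁻¹ * ((4 * Real.pi * w) ^ (1 / 2 : ℂ))⁻¹) *
          Complex.exp (b * s ^ 2 + (2 * (4 * w)⁻¹ * r) * s + (-(4 * w)⁻¹ * r ^ 2)) := by
      intro s
      unfold heatKernel
      rw [mul_mul_mul_comm, ← Complex.exp_add]
      congr 2
      push_cast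
      rw [hb]
      ring
    simp_rw [e1]
    rw [integral_const_mul, integral_cexp_quadratic hbre, heatKernel]
    have e2 : -(4 * w)⁻¹ * (r : ℂ) ^ 2 - (2 * (4 * w)⁻¹ * r) ^ 2 / (4 * b) =
        -(4 * (z + w))⁻¹ * (r : ℂ) ^ 2 := by
      have hb0 : b = -(z + w) / (4 * z * w) := by
        rw [hb]; field_simp; ring
      rw [hb0]
      field_simp
      ring
    rw [e2]
    have := four_pi_mul_cpow_ne_zero hzw
    field_simp
  have h1 := integral_convolution (ContinuousLinearMap.mul ℂ ℂ) (μ := volume) (ν := volume)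
    (integrable_heatKernel hz) (integrable_heatKernel hw)
  simp only [convolution, ContinuousLinearMap.mul_apply', hC, integral_heatKernel hz,
    integral_heatKernel hw] at h1
  rw [integral_const_mul, integral_heatKernel hzw, mul_one, mul_one] at h1
  rw [hC, h1, one_mul]

theorem heatKernel_ofReal {t : ℝ} (ht : 0 < t) (s : ℝ) :
    heatKernel t s = (((Real.sqrt (4 * Real.pi * t))⁻¹ * Real.exp (-(4 * t)⁻¹ * s ^ 2) : ℝ) : ℂ) := by
  have h : (0 : ℝ) ≤ 4 * Real.pi * t := by positivity
  have e : (4 * Real.pi * t : ℂ) ^ (1 / 2 : ℂ) = ((Real.sqrt (4 * Real.pi * t) : ℝ) : ℂ) := by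
    rw [Real.sqrt_eq_rpow, Complex.ofReal_cpow h]
    push_cast
    rfl
  rw [heatKernel, e]
  push_cast
  rfl

theorem integral_norm_heatKernel {t : ℝ} (ht : 0 < t) : ∫ s, ‖heatKernel t s‖ = 1 := by
  have h1 := integral_heatKernel (z := (t : ℂ)) (by simpa using ht)
  simp_rw [heatKernel_ofReal ht] at h1 ⊢
  rw [integral_complex_ofReal] at h1
  have h2 : ∀ s : ℝ, ‖(((Real.sqrt (4 * Real.pi * t))⁻¹ * Real.exp (-(4 * t)⁻¹ * s ^ 2) : ℝ) : ℂ)‖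
      = (Real.sqrt (4 * Real.pi * t))⁻¹ * Real.exp (-(4 * t)⁻¹ * s ^ 2) := fun s => by
    rw [Complex.norm_real, Real.norm_of_nonneg (by positivity)]
  simp_rw [h2]
  exact_mod_cast h1

/-- Parabolic scaling of the heat kernel at real times. -/
theorem sqrt_mul_heatKernel {t : ℝ} (ht : 0 < t) (r : ℝ) :
    (Real.sqrt t : ℂ) * heatKernel t (Real.sqrt t * r) = heatKernel (1 : ℝ) r := by
  rw [heatKernel_ofReal ht, heatKernel_ofReal one_pos, ← Complex.ofReal_mul]
  congr 1
  rw [Real.sqrt_mul (by positivity), mul_pow, Real.sq_sqrt ht.le]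
  have : Real.sqrt t ≠ 0 := (Real.sqrt_pos.2 ht).ne'
  have e : -(4 * t)⁻¹ * (t * r ^ 2) = -(4 * 1)⁻¹ * r ^ 2 := by field_simp
  rw [e, mul_one]
  field_simp

/-- In the sector `|arg z| ≤ θ < π/2` the rescaled heat kernels have a common integrable bound. -/
theorem norm_sqrt_mul_heatKernel_le {z : ℂ} (hz : z ≠ 0) {θ : ℝ} (hθ : |z.arg| ≤ θ)
    (hθ' : θ < Real.pi / 2) (r : ℝ) :
    ‖(Real.sqrt ‖z‖ : ℂ) * heatKernel z (Real.sqrt ‖z‖ * r)‖ ≤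
      (Real.sqrt (4 * Real.pi))⁻¹ * Real.exp (-(Real.cos θ / 4) * r ^ 2) := by
  have hn : 0 < ‖z‖ := norm_pos_iff.2 hz
  have hcos : Real.cos θ ≤ Real.cos z.arg := by
    rw [← Real.cos_abs z.arg]
    exact Real.cos_le_cos_of_nonneg_of_le_pi (abs_nonneg _) (by linarith [Real.pi_pos]) hθ
  have hre : ‖z‖ * Real.cos z.arg = z.re := Complex.norm_mul_cos_arg z
  have e1 : ‖(4 * Real.pi * z : ℂ) ^ (1 / 2 : ℂ)‖ =
      Real.sqrt (4 * Real.pi) * Real.sqrt ‖z‖ := by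
    rw [show (1 / 2 : ℂ) = ((1 / 2 : ℝ) : ℂ) by push_cast; rfl,
      Complex.norm_cpow_of_ne_zero (by simpa [Real.pi_ne_zero] using hz)]
    simp only [Complex.ofReal_re, Complex.ofReal_im, mul_zero, Real.exp_zero, div_one, norm_mul,
      Complex.norm_real, Real.norm_eq_abs, abs_of_pos Real.pi_pos]
    rw [← Real.sqrt_eq_rpow, ← Real.sqrt_mul (by positivity)]
    norm_num
  have e2 : (-(4 * z)⁻¹ * ((Real.sqrt ‖z‖ * r : ℝ) : ℂ) ^ 2).re =
      -(Real.cos z.arg / 4) * r ^ 2 := by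
    rw [← Complex.ofReal_pow, Complex.re_mul_ofReal, Complex.neg_re, Complex.inv_re, mul_pow,
      Real.sq_sqrt hn.le, Complex.normSq_mul, Complex.normSq_eq_norm_sq z]
    have : (4 * z).re = 4 * (‖z‖ * Real.cos z.arg) := by rw [hre]; simp
    rw [this]
    have h4 : Complex.normSq 4 = 16 := by
      rw [Complex.normSq_eq_norm_sq]; norm_num
    rw [h4]
    field_simp
    ring
  rw [heatKernel, norm_mul, norm_mul, norm_inv, e1, Complex.norm_exp, e2, Complex.norm_real,
    Real.norm_of_nonneg (Real.sqrt_nonneg _)]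
  have hs : Real.sqrt ‖z‖ ≠ 0 := (Real.sqrt_pos.2 hn).ne'
  have : Real.sqrt ‖z‖ * ((Real.sqrt (4 * Real.pi) * Real.sqrt ‖z‖)⁻¹ *
      Real.exp (-(Real.cos z.arg / 4) * r ^ 2)) =
      (Real.sqrt (4 * Real.pi))⁻¹ * Real.exp (-(Real.cos z.arg / 4) * r ^ 2) := by
    field_simp
  rw [this]
  gcongr

theorem integrable_pow_mul_exp_neg_mul_sq {b : ℝ} (hb : 0 < b) (n : ℕ) :
    Integrable fun x : ℝ => x ^ n * Real.exp (-b * x ^ 2) := by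
  have := integrable_rpow_mul_exp_neg_mul_sq hb (s := n) (by
    have : (0 : ℝ) ≤ n := n.cast_nonneg
    linarith)
  simpa using this

theorem integrable_pow_mul_cexp_neg_mul_sq {b : ℂ} (hb : 0 < b.re) (n : ℕ) :
    Integrable fun x : ℝ => (x : ℂ) ^ n * Complex.exp (-b * (x : ℂ) ^ 2) := by
  refine (integrable_pow_mul_exp_neg_mul_sq hb n).norm.mono' ?_ (ae_of_all _ fun x => ?_)
  · exact (by fun_prop : Continuous fun x : ℝ =>
      (x : ℂ) ^ n * Complex.exp (-b * (x : ℂ) ^ 2)).aestronglyMeasurable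
  · rw [norm_mul, norm_mul, norm_cexp_neg_mul_sq, norm_pow, norm_pow, Complex.norm_real,
      Real.norm_of_nonneg (Real.exp_pos _).le]

theorem integrable_heatKernel_mul_pow {z : ℂ} (hz : 0 < z.re) (n : ℕ) :
    Integrable fun r : ℝ => heatKernel z r * (r : ℂ) ^ n := by
  refine ((integrable_pow_mul_cexp_neg_mul_sq (re_inv_four_mul_pos hz) n).const_mul
    ((4 * Real.pi * z) ^ (1 / 2 : ℂ))⁻¹).congr (ae_of_all _ fun r => ?_)
  simp only [heatKernel]
  ring

theorem integral_heatKernel_mul_id (z : ℂ) : ∫ r : ℝ, heatKernel z r * (r : ℂ) = 0 := by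
  have h := integral_neg_eq_self (fun r : ℝ => heatKernel z r * (r : ℂ)) volume
  have : ∀ r : ℝ, heatKernel z (-r) * ((-r : ℝ) : ℂ) = -(heatKernel z r * (r : ℂ)) := fun r => by
    simp [heatKernel]
  simp_rw [this, integral_neg] at h
  linear_combination (-1 / 2 : ℂ) * h

theorem integral_heatKernel_one_mul_sq :
    ∫ r : ℝ, heatKernel (1 : ℝ) r * (r : ℂ) ^ 2 = 2 := by
  have h1 : (0 : ℝ) < ((1 : ℝ) : ℂ).re := by simp
  have hd : ∀ r : ℝ, HasDerivAt (heatKernel (1 : ℝ)) (-(1 / 2) * (r : ℂ) * heatKernel (1 : ℝ) r) r := by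
    intro r
    have h2 : HasDerivAt (fun r : ℝ => (r : ℂ)) 1 r := Complex.ofRealCLM.hasDerivAt
    have h3 := (((h2.pow 2).const_mul (-(4 * ((1 : ℝ) : ℂ))⁻¹)).cexp).const_mul
      ((4 * Real.pi * ((1 : ℝ) : ℂ)) ^ (1 / 2 : ℂ))⁻¹
    refine h3.congr_deriv ?_
    simp only [heatKernel, Pi.pow_apply]
    push_cast
    ring
  have hi0 := integrable_heatKernel h1
  have hi1 := integrable_heatKernel_mul_pow h1 1
  have hi2 := integrable_heatKernel_mul_pow h1 2
  have := integral_mul_deriv_eq_deriv_mul_of_integrable (u := fun r : ℝ => (r : ℂ))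
    (v := heatKernel (1 : ℝ)) (u' := fun _ => 1)
    (v' := fun r => -(1 / 2) * (r : ℂ) * heatKernel (1 : ℝ) r)
    (fun r _ => Complex.ofRealCLM.hasDerivAt) (fun r _ => hd r)
    ((hi2.const_mul (-(1 / 2))).congr (ae_of_all _ fun r => by simp only [Pi.mul_apply]; ring))
    (hi0.congr (ae_of_all _ fun r => by simp))
    (hi1.congr (ae_of_all _ fun r => by simp only [Pi.mul_apply]; ring))
  simp only [one_mul, integral_heatKernel h1] at this
  have e : ∀ r : ℝ, (r : ℂ) * (-(1 / 2) * (r : ℂ) * heatKernel (1 : ℝ) r) =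
      -(1 / 2) * (heatKernel (1 : ℝ) r * (r : ℂ) ^ 2) := fun r => by ring
  simp_rw [e] at this
  rw [integral_const_mul] at this
  linear_combination (-2 : ℂ) * this

/-- The first-order Taylor expansion of `w ↦ e^{-w s²}` has a quadratic error in `L_1(ds)`. -/
theorem exists_integral_norm_gaussian_sub_le {w : ℂ} (hw : 0 < w.re) : ∃ C : ℝ, ∀ h : ℂ,
    ‖h‖ ≤ w.re / 2 →
    ∫ s : ℝ, ‖Complex.exp (-(w + h) * (s : ℂ) ^ 2) - Complex.exp (-w * (s : ℂ) ^ 2) +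
      h * ((s : ℂ) ^ 2 * Complex.exp (-w * (s : ℂ) ^ 2))‖ ≤ C * ‖h‖ ^ 2 := by
  refine ⟨∫ s : ℝ, s ^ 4 * Real.exp (-(w.re / 2) * s ^ 2), fun h hh => ?_⟩
  have hi := integrable_pow_mul_exp_neg_mul_sq (half_pos hw) 4
  rw [mul_comm, ← integral_const_mul]
  refine integral_mono_of_nonneg (ae_of_all _ fun s => norm_nonneg _) (hi.const_mul _)
    (ae_of_all _ fun s => ?_)
  have e : Complex.exp (-(w + h) * (s : ℂ) ^ 2) - Complex.exp (-w * (s : ℂ) ^ 2) +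
      h * ((s : ℂ) ^ 2 * Complex.exp (-w * (s : ℂ) ^ 2)) = Complex.exp (-w * (s : ℂ) ^ 2) *
      (Complex.exp (-h * (s : ℂ) ^ 2) -
        ∑ m ∈ Finset.range 2, (-h * (s : ℂ) ^ 2) ^ m / m.factorial) := by
    rw [show -(w + h) * (s : ℂ) ^ 2 = -w * (s : ℂ) ^ 2 + -h * (s : ℂ) ^ 2 by ring, Complex.exp_add]
    simp only [Finset.sum_range_succ, Finset.sum_range_zero, Nat.factorial]
    push_cast
    ring
  have hx : ‖-h * (s : ℂ) ^ 2‖ = ‖h‖ * s ^ 2 := by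
    rw [norm_mul, norm_neg, norm_pow, Complex.norm_real, Real.norm_eq_abs, sq_abs]
  have h1 := Complex.norm_exp_sub_sum_le_norm_mul_exp (-h * (s : ℂ) ^ 2) 2
  simp only []
  rw [e, norm_mul, norm_cexp_neg_mul_sq]
  calc Real.exp (-w.re * s ^ 2) * _ ≤ Real.exp (-w.re * s ^ 2) *
        ((‖h‖ * s ^ 2) ^ 2 * Real.exp (w.re / 2 * s ^ 2)) := by
        rw [hx] at h1
        gcongr
        exact h1.trans (by gcongr)
    _ = ‖h‖ ^ 2 * (s ^ 4 * Real.exp (-(w.re / 2) * s ^ 2)) := by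
        rw [show -(w.re / 2) * s ^ 2 = -w.re * s ^ 2 + w.re / 2 * s ^ 2 by ring, Real.exp_add]
        ring

end HeatKernel

/-! ### The heat semigroup of a group -/

section HeatSemigroup

variable {μ : Measure ℝ} {T : ℝ → WeakStarLinf μ →L[ℂ] WeakStarLinf μ}

theorem continuous_toLinf_symm : Continuous (toLinf.symm : Lp ℂ ∞ μ → WeakStarLinf μ) :=
  continuous_weakStar fun ψ =>
    (((ContinuousLinearMap.mul ℂ ℂ).lpPairing μ ∞ 1).flip ψ).continuous

/-- The operator `e^{zA²} = ∫ (4πz)^{-1/2} e^{-s²/(4z)} T_s ds`, where `A` is the generator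
of `T`. -/
def heatOp (T : ℝ → WeakStarLinf μ →L[ℂ] WeakStarLinf μ) (z : ℂ) :
    WeakStarLinf μ →L[ℂ] WeakStarLinf μ := groupAverage T (heatKernel z)

open Classical in
/-- The semigroup `e^{tA²}`, `t ≥ 0`, where `A` is the generator of `T`. At negative `t` it is the
identity. -/
def heatSemigroup (T : ℝ → WeakStarLinf μ →L[ℂ] WeakStarLinf μ) (t : ℝ) :
    WeakStarLinf μ →L[ℂ] WeakStarLinf μ :=
  if 0 < t then heatOp T t else ContinuousLinearMap.id ℂ _

theorem heatSemigroup_of_pos {t : ℝ} (ht : 0 < t) : heatSemigroup T t = heatOp T t := if_pos ht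

theorem heatSemigroup_zero : heatSemigroup T 0 = ContinuousLinearMap.id ℂ _ := if_neg (lt_irrefl _)

namespace IsAveragingGroup

/-- Averaging turns convolution of kernels into composition of operators. -/
theorem groupAverage_comp [SigmaFinite μ] (hT : IsAveragingGroup T) {k l : ℝ → ℂ}
    (hk : Integrable k) (hl : Integrable l) :
    (groupAverage T k).comp (groupAverage T l) = groupAverage T fun r => ∫ s, k s * l (r - s) := by
  have hkl : Integrable fun r => ∫ s, k s * l (r - s) :=
    hk.integrable_convolution (ContinuousLinearMap.mul ℂ ℂ) hl
  have hint : Integrable (fun p : ℝ × ℝ => k p.2 * l (p.1 - p.2)) (volume.prod volume) :=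
    hk.convolution_integrand (ContinuousLinearMap.mul ℂ ℂ) hl
  ext φ
  refine weakStar_ext fun ψ => ?_
  rw [ContinuousLinearMap.comp_apply, hT.evalAt_groupAverage hk, hT.evalAt_groupAverage hkl]
  have e1 : ∀ s, k s * evalAt ψ (T s (groupAverage T l φ)) =
      ∫ r, k s * l (r - s) * evalAt ψ (T r φ) := by
    intro s
    obtain ⟨ψ', hψ'⟩ := evalAt_comp ψ (T s)
    rw [hψ', hT.evalAt_groupAverage hl, ← integral_const_mul,
      ← integral_sub_right_eq_self _ s]
    refine integral_congr_ae (ae_of_all _ fun r => ?_)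
    have : T r = (T s).comp (T (r - s)) := by rw [← hT.add, add_sub_cancel]
    simp only [this, ContinuousLinearMap.comp_apply, hψ', mul_assoc]
  have hint' : Integrable (fun p : ℝ × ℝ => k p.2 * l (p.1 - p.2) * evalAt ψ (T p.1 φ))
      (volume.prod volume) :=
    hint.mul_bdd (c := ‖toLinf φ‖ * ‖ψ‖)
      (((hT.continuous_evalAt φ ψ).comp continuous_fst).aestronglyMeasurable)
      (ae_of_all _ fun p => hT.norm_evalAt_le φ ψ p.1)
  simp_rw [e1]
  have hswap := integral_integral_swap
    (f := fun s r => k s * l (r - s) * evalAt ψ (T r φ)) hint'.swap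
  simp_rw [integral_mul_const] at hswap
  exact hswap

theorem heatOp_add [SigmaFinite μ] (hT : IsAveragingGroup T) {z w : ℂ} (hz : 0 < z.re)
    (hw : 0 < w.re) : heatOp T (z + w) = (heatOp T z).comp (heatOp T w) := by
  rw [heatOp, heatOp, heatOp,
    hT.groupAverage_comp (integrable_heatKernel hz) (integrable_heatKernel hw)]
  congr 1
  funext r
  exact (heatKernel_convolution hz hw r).symm

theorem hasDerivAt_groupAverage_gaussian [SigmaFinite μ] (hT : IsAveragingGroup T)
    (φ : WeakStarLinf μ) {w : ℂ} (hw : 0 < w.re) :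
    HasDerivAt (fun w : ℂ =>
        toLinf (groupAverage T (fun s : ℝ => Complex.exp (-w * (s : ℂ) ^ 2)) φ))
      (-toLinf (groupAverage T (fun s : ℝ => (s : ℂ) ^ 2 * Complex.exp (-w * (s : ℂ) ^ 2)) φ))
      w := by
  obtain ⟨C, hC⟩ := exists_integral_norm_gaussian_sub_le hw
  rw [hasDerivAt_iff_isLittleO_nhds_zero]
  have hbig : (fun h : ℂ =>
      toLinf (groupAverage T (fun s : ℝ => Complex.exp (-(w + h) * (s : ℂ) ^ 2)) φ) -
      toLinf (groupAverage T (fun s : ℝ => Complex.exp (-w * (s : ℂ) ^ 2)) φ) -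
      h • -toLinf (groupAverage T
        (fun s : ℝ => (s : ℂ) ^ 2 * Complex.exp (-w * (s : ℂ) ^ 2)) φ)) =O[𝓝 0]
      fun h : ℂ => h ^ 2 := by
    refine Asymptotics.IsBigO.of_bound (C * ‖toLinf φ‖) ?_
    filter_upwards [Metric.closedBall_mem_nhds (0 : ℂ) (half_pos hw)] with h hh
    have hh' : ‖h‖ ≤ w.re / 2 := by simpa using hh
    have hwh : 0 < (w + h).re := by
      have := (abs_le.1 ((Complex.abs_re_le_norm h).trans hh')).1
      rw [Complex.add_re]
      linarith
    have i1 := integrable_cexp_neg_mul_sq hwh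
    have i2 := integrable_cexp_neg_mul_sq hw
    have i3 := (integrable_pow_mul_cexp_neg_mul_sq hw 2).const_mul h
    have i4 : Integrable fun s : ℝ => Complex.exp (-(w + h) * (s : ℂ) ^ 2) -
        Complex.exp (-w * (s : ℂ) ^ 2) + h * ((s : ℂ) ^ 2 * Complex.exp (-w * (s : ℂ) ^ 2)) :=
      (i1.sub i2).add i3
    have e : toLinf (groupAverage T (fun s : ℝ => Complex.exp (-(w + h) * (s : ℂ) ^ 2)) φ) -
        toLinf (groupAverage T (fun s : ℝ => Complex.exp (-w * (s : ℂ) ^ 2)) φ) -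
        h • -toLinf (groupAverage T
          (fun s : ℝ => (s : ℂ) ^ 2 * Complex.exp (-w * (s : ℂ) ^ 2)) φ) =
        toLinf (groupAverage T (fun s : ℝ => Complex.exp (-(w + h) * (s : ℂ) ^ 2) -
          Complex.exp (-w * (s : ℂ) ^ 2) +
          h * ((s : ℂ) ^ 2 * Complex.exp (-w * (s : ℂ) ^ 2))) φ) := by
      rw [← map_neg, ← map_smul, ← map_sub, ← map_sub]
      congr 1
      refine weakStar_ext fun ψ => ?_
      rw [map_sub, map_sub, map_smul, map_neg, hT.evalAt_groupAverage i1,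
        hT.evalAt_groupAverage i2, hT.evalAt_groupAverage (integrable_pow_mul_cexp_neg_mul_sq hw 2),
        hT.evalAt_groupAverage i4, smul_neg, sub_neg_eq_add, smul_eq_mul, ← integral_const_mul,
        ← integral_sub (hT.integrable_mul_evalAt i1 φ ψ) (hT.integrable_mul_evalAt i2 φ ψ),
        ← integral_add]
      · refine integral_congr_ae (ae_of_all _ fun s => ?_)
        simp only []
        ring
      · exact (hT.integrable_mul_evalAt i1 φ ψ).sub (hT.integrable_mul_evalAt i2 φ ψ)
      · exact (hT.integrable_mul_evalAt (integrable_pow_mul_cexp_neg_mul_sq hw 2) φ ψ).const_mul h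
    rw [e]
    refine (hT.norm_groupAverage_le i4 φ).trans ?_
    rw [norm_pow, mul_right_comm]
    exact mul_le_mul_of_nonneg_right (hC h hh') (norm_nonneg _)
  exact hbig.trans_isLittleO (Asymptotics.isLittleO_pow_id one_lt_two)

theorem differentiableOn_heatOp [SigmaFinite μ] (hT : IsAveragingGroup T) (φ : WeakStarLinf μ) :
    DifferentiableOn ℂ (fun z => toLinf (heatOp T z φ)) {z | 0 < z.re} := by
  have e : ∀ z ∈ {z : ℂ | 0 < z.re}, toLinf (heatOp T z φ) =
      ((4 * Real.pi * z) ^ (1 / 2 : ℂ))⁻¹ •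
        toLinf (groupAverage T (fun s : ℝ => Complex.exp (-(4 * z)⁻¹ * (s : ℂ) ^ 2)) φ) := by
    intro z hz
    rw [← map_smul]
    congr 1
    refine weakStar_ext fun ψ => ?_
    rw [map_smul, heatOp, hT.evalAt_groupAverage (integrable_heatKernel hz),
      hT.evalAt_groupAverage (integrable_cexp_neg_mul_sq (re_inv_four_mul_pos hz)), smul_eq_mul,
      ← integral_const_mul]
    simp only [heatKernel, mul_assoc]
  refine DifferentiableOn.congr (fun z hz => ?_) e
  refine DifferentiableAt.differentiableWithinAt ?_
  have hz0 := ne_zero_of_re_pos hz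
  have hslit : 4 * (Real.pi : ℂ) * z ∈ Complex.slitPlane := by
    refine Or.inl ?_
    have : (4 * (Real.pi : ℂ) * z).re = 4 * Real.pi * z.re := by simp
    rw [this]
    have : 0 < z.re := hz
    have := Real.pi_pos
    positivity
  have d1 : DifferentiableAt ℂ (fun z : ℂ => ((4 * Real.pi * z) ^ (1 / 2 : ℂ))⁻¹) z := by
    refine DifferentiableAt.inv ?_ (four_pi_mul_cpow_ne_zero hz)
    exact (differentiableAt_id.const_mul _).cpow_const hslit
  have d2 : DifferentiableAt ℂ (fun z : ℂ => (4 * z)⁻¹) z :=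
    (differentiableAt_id.const_mul _).inv (by simpa using hz0)
  have d3 := (hT.hasDerivAt_groupAverage_gaussian φ (re_inv_four_mul_pos hz)).differentiableAt
  exact d1.smul (DifferentiableAt.comp (g := fun w : ℂ =>
    toLinf (groupAverage T (fun s : ℝ => Complex.exp (-w * (s : ℂ) ^ 2)) φ)) z d3 d2)

theorem continuousOn_heatOp [SigmaFinite μ] (hT : IsAveragingGroup T) (φ : WeakStarLinf μ) :
    ContinuousOn (fun z => heatOp T z φ) {z | 0 < z.re} :=
  continuous_toLinf_symm.comp_continuousOn (hT.differentiableOn_heatOp φ).continuousOn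

theorem evalAt_heatOp_scaled (hT : IsAveragingGroup T) {z : ℂ} (hz : 0 < z.re) {c : ℝ}
    (hc : 0 < c) (φ : WeakStarLinf μ) (ψ : Lp ℂ 1 μ) :
    evalAt ψ (heatOp T z φ) =
      ∫ r, ((c : ℂ) * heatKernel z (c * r)) * evalAt ψ (T (c * r) φ) := by
  rw [heatOp, hT.evalAt_groupAverage (integrable_heatKernel hz)]
  have := Measure.integral_comp_mul_left (fun s => heatKernel z s * evalAt ψ (T s φ)) c
  simp_rw [mul_assoc]
  rw [integral_const_mul, this, abs_of_pos (inv_pos.2 hc), Complex.real_smul, ← mul_assoc,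
    ← Complex.ofReal_mul, mul_inv_cancel₀ hc.ne', Complex.ofReal_one, one_mul]

/-- After rescaling by `|z|^{1/2}` the heat kernels in a sector are dominated by one Gaussian. -/
theorem tendsto_heatOp_sector [SigmaFinite μ] (hT : IsAveragingGroup T) (φ : WeakStarLinf μ)
    {θ : ℝ} (hθ : θ < Real.pi / 2) :
    Tendsto (fun z => heatOp T z φ) (𝓝[{z | z ≠ 0 ∧ |z.arg| ≤ θ}] 0) (𝓝 φ) := by
  rcases lt_or_ge θ 0 with hneg | hθ0
  · have : {z : ℂ | z ≠ 0 ∧ |z.arg| ≤ θ} = ∅ := by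
      ext z
      simp only [Set.mem_ofPred_eq, Set.mem_empty_iff_false, iff_false, not_and, not_le]
      exact fun _ => hneg.trans_le (abs_nonneg _)
    rw [this, nhdsWithin_empty]
    exact tendsto_bot
  have hcos : 0 < Real.cos θ :=
    Real.cos_pos_of_mem_Ioo ⟨by linarith [Real.pi_pos], hθ⟩
  rw [tendsto_weakStar]
  intro ψ
  set m : ℝ → ℂ := fun s => evalAt ψ (T s φ) with hm
  have hmc : Continuous m := hT.continuous_evalAt φ ψ
  have hm0 : m 0 = evalAt ψ φ := by simp [hm, hT.zero]
  set g : ℝ → ℝ := fun r => (Real.sqrt (4 * Real.pi))⁻¹ * Real.exp (-(Real.cos θ / 4) * r ^ 2)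
    with hg
  have hgi : Integrable g := (integrable_exp_neg_mul_sq (by positivity)).const_mul _
  set M := ‖toLinf φ‖ * ‖ψ‖
  have hmM : ∀ s, ‖m s‖ ≤ M := hT.norm_evalAt_le φ ψ
  have hlim : Tendsto (fun z : ℂ => ∫ r, g r * ‖m (Real.sqrt ‖z‖ * r) - m 0‖)
      (𝓝[{z | z ≠ 0 ∧ |z.arg| ≤ θ}] 0) (𝓝 0) := by
    have : (0 : ℝ) = ∫ r : ℝ, (0 : ℝ) := by simp
    rw [this]
    refine tendsto_integral_filter_of_dominated_convergence (fun r => g r * (M + M)) ?_ ?_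
      (hgi.mul_const _) ?_
    · refine Eventually.of_forall fun z => Continuous.aestronglyMeasurable ?_
      fun_prop
    · refine Eventually.of_forall fun z => ae_of_all _ fun r => ?_
      have hg0 : 0 ≤ g r := by positivity
      rw [norm_mul, norm_norm, Real.norm_of_nonneg hg0]
      gcongr
      exact (norm_sub_le _ _).trans (add_le_add (hmM _) (hmM _))
    · refine ae_of_all _ fun r => Tendsto.mono_left ?_ nhdsWithin_le_nhds
      have : Continuous fun z : ℂ => g r * ‖m (Real.sqrt ‖z‖ * r) - m 0‖ := by fun_prop
      simpa using this.tendsto 0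
  rw [tendsto_iff_norm_sub_tendsto_zero]
  refine squeeze_zero' (Eventually.of_forall fun _ => norm_nonneg _) ?_ hlim
  filter_upwards [self_mem_nhdsWithin] with z hz
  obtain ⟨hz0, hzθ⟩ := hz
  have hre : 0 < z.re := by
    rw [← Complex.norm_mul_cos_arg z]
    refine mul_pos (norm_pos_iff.2 hz0) (Real.cos_pos_of_mem_Ioo ?_)
    rw [Set.mem_Ioo, ← abs_lt]
    exact hzθ.trans_lt hθ
  have hc : 0 < Real.sqrt ‖z‖ := Real.sqrt_pos.2 (norm_pos_iff.2 hz0)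
  have hki : Integrable fun r : ℝ => (Real.sqrt ‖z‖ : ℂ) * heatKernel z (Real.sqrt ‖z‖ * r) :=
    ((integrable_heatKernel hre).comp_mul_left' hc.ne').const_mul _
  have h1 : ∫ r : ℝ, (Real.sqrt ‖z‖ : ℂ) * heatKernel z (Real.sqrt ‖z‖ * r) = 1 := by
    have := Measure.integral_comp_mul_left (heatKernel z) (Real.sqrt ‖z‖)
    rw [integral_const_mul, this, abs_of_pos (inv_pos.2 hc), Complex.real_smul, ← mul_assoc,
      ← Complex.ofReal_mul, mul_inv_cancel₀ hc.ne', Complex.ofReal_one, one_mul,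
      integral_heatKernel hre]
  have h2 : evalAt ψ (heatOp T z φ) - evalAt ψ φ =
      ∫ r : ℝ, ((Real.sqrt ‖z‖ : ℂ) * heatKernel z (Real.sqrt ‖z‖ * r)) *
        (m (Real.sqrt ‖z‖ * r) - m 0) := by
    simp_rw [mul_sub]
    rw [integral_sub, integral_mul_const, h1, one_mul, hm0, hT.evalAt_heatOp_scaled hre hc]
    · exact hki.mul_bdd (hmc.comp (by fun_prop)).aestronglyMeasurable
        (ae_of_all _ fun r => hmM _)
    · exact hki.mul_const _
  rw [h2]
  refine norm_integral_le_of_norm_le ?_ (ae_of_all _ fun r => ?_)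
  · refine Integrable.mul_bdd (c := M + M) hgi ?_ (ae_of_all _ fun r => ?_)
    · exact (by fun_prop : Continuous fun r : ℝ => ‖m (Real.sqrt ‖z‖ * r) - m 0‖).aestronglyMeasurable
    · rw [norm_norm]
      exact (norm_sub_le _ _).trans (add_le_add (hmM _) (hmM _))
  · rw [norm_mul]
    gcongr
    exact norm_sqrt_mul_heatKernel_le hz0 hzθ hθ r

theorem isHolomorphic_heatSemigroup [SigmaFinite μ] (hT : IsAveragingGroup T) :
    IsHolomorphicRightHalfPlane (heatSemigroup T) :=
  ⟨heatOp T, fun _ ht => (heatSemigroup_of_pos ht).symm, fun _ _ hz hw => hT.heatOp_add hz hw,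
    hT.differentiableOn_heatOp, fun φ _ hθ => hT.tendsto_heatOp_sector φ hθ⟩

theorem isWeakStarSemigroup_heatSemigroup [SigmaFinite μ] (hT : IsAveragingGroup T) :
    IsWeakStarSemigroup (heatSemigroup T) where
  zero := heatSemigroup_zero
  add := by
    intro s t hs ht
    rcases hs.eq_or_lt with rfl | hs
    · rw [zero_add, heatSemigroup_zero, ContinuousLinearMap.id_comp]
    rcases ht.eq_or_lt with rfl | ht
    · rw [add_zero, heatSemigroup_zero, ContinuousLinearMap.comp_id]
    rw [heatSemigroup_of_pos hs, heatSemigroup_of_pos ht, heatSemigroup_of_pos (add_pos hs ht),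
      ← hT.heatOp_add (by simpa using hs) (by simpa using ht), Complex.ofReal_add]
  continuousOn := by
    intro φ t ht
    rcases (Set.mem_Ici.1 ht).eq_or_lt with rfl | ht
    · rw [← continuousWithinAt_Ioi_iff_Ici, ContinuousWithinAt, heatSemigroup_zero]
      have h1 := hT.tendsto_heatOp_sector φ (θ := 0) (by positivity)
      have h2 : Tendsto (fun t : ℝ => (t : ℂ)) (𝓝[>] 0) (𝓝[{z | z ≠ 0 ∧ |z.arg| ≤ 0}] 0) := by
        refine tendsto_nhdsWithin_iff.2 ⟨?_, ?_⟩
        · exact (Complex.continuous_ofReal.tendsto' 0 0 (by simp)).mono_left nhdsWithin_le_nhds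
        · filter_upwards [self_mem_nhdsWithin] with t ht
          exact ⟨by simpa using (Set.mem_Ioi.1 ht).ne', by
            simp [Complex.arg_ofReal_of_nonneg (le_of_lt ht)]⟩
      refine (h1.comp h2).congr' ?_
      filter_upwards [self_mem_nhdsWithin] with t ht
      rw [Function.comp, heatSemigroup_of_pos ht]
    · refine ContinuousAt.continuousWithinAt ?_
      have h1 : ContinuousAt (fun z => heatOp T z φ) (t : ℂ) :=
        (hT.continuousOn_heatOp φ).continuousAt
          ((isOpen_lt continuous_const Complex.continuous_re).mem_nhds (by simpa using ht))
      refine (ContinuousAt.comp (f := fun t : ℝ => (t : ℂ)) h1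
        Complex.continuous_ofReal.continuousAt).congr ?_
      filter_upwards [lt_mem_nhds ht] with s hs
      rw [Function.comp, heatSemigroup_of_pos hs]

theorem isContractiveFamily_heatSemigroup (hT : IsAveragingGroup T) :
    IsContractiveFamily (heatSemigroup T) := by
  intro t ht φ
  rcases ht.eq_or_lt with rfl | ht
  · rw [heatSemigroup_zero]; rfl
  · rw [heatSemigroup_of_pos ht]
    have := hT.norm_groupAverage_le (integrable_heatKernel (z := t) (by simpa using ht)) φ
    rwa [integral_norm_heatKernel ht, one_mul] at this

end IsAveragingGroup

end HeatSemigroup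

/-! ### The generator of the heat semigroup, and positivity -/

section HeatGenerator

theorem norm_taylor_two_le {m n p : ℝ → ℂ} {M : ℝ} (hm : ∀ t, HasDerivAt m (n t) t)
    (hn : ∀ t, HasDerivAt n (p t) t) (hp : ∀ t, ‖p t‖ ≤ M) (s : ℝ) :
    ‖m s - m 0 - s * n 0‖ ≤ M * s ^ 2 := by
  have h1 : ∀ r, ‖n r - n 0‖ ≤ M * |r| := fun r => by
    have := convex_univ.norm_image_sub_le_of_norm_hasDerivWithin_le
      (fun x _ => (hn x).hasDerivWithinAt) (fun x _ => hp x) (Set.mem_univ 0) (Set.mem_univ r)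
    simpa using this
  have h2 : ∀ r, HasDerivAt (fun r : ℝ => m r - r * n 0) (n r - n 0) r := fun r => by
    have := (hm r).sub ((Complex.ofRealCLM.hasDerivAt (x := r)).mul_const (n 0))
    refine this.congr_deriv ?_
    simp
  have h3 := (convex_uIcc 0 s).norm_image_sub_le_of_norm_hasDerivWithin_le (C := M * |s|)
    (fun x _ => (h2 x).hasDerivWithinAt) (fun x hx => (h1 x).trans ?_)
    Set.left_mem_uIcc Set.right_mem_uIcc
  · have e : m s - s * n 0 - (m 0 - (0 : ℝ) * n 0) = m s - m 0 - s * n 0 := by simp; ring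
    rw [e, sub_zero, Real.norm_eq_abs, mul_assoc, abs_mul_abs_self] at h3
    rwa [sq]
  · have hM : 0 ≤ M := (norm_nonneg _).trans (hp 0)
    have := Set.abs_sub_left_of_mem_uIcc hx
    rw [sub_zero, sub_zero] at this
    gcongr

theorem tendsto_taylor_two {m n : ℝ → ℂ} {p : ℂ} (hm : ∀ t, HasDerivAt m (n t) t)
    (hn : HasDerivAt n p 0) :
    Tendsto (fun s : ℝ => (m s - m 0 - s * n 0) / (s : ℂ) ^ 2) (𝓝[≠] 0) (𝓝 (p / 2)) := by
  rw [Metric.tendsto_nhdsWithin_nhds]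
  intro ε hε
  have hlo := hasDerivAt_iff_isLittleO.1 hn
  have hb := (Asymptotics.isLittleO_iff.1 hlo) (half_pos hε)
  obtain ⟨δ, hδ, hball⟩ := Metric.eventually_nhds_iff.1 hb
  refine ⟨δ, hδ, fun {s} hs0 hs => ?_⟩
  have hd : ∀ r, HasDerivAt (fun r : ℝ => m r - r * n 0 - r ^ 2 * (p / 2)) (n r - n 0 - r * p) r := by
    intro r
    have h0 : HasDerivAt (fun r : ℝ => (r : ℂ)) 1 r := Complex.ofRealCLM.hasDerivAt
    refine (((hm r).sub (h0.mul_const (n 0))).sub ((h0.pow 2).mul_const (p / 2))).congr_deriv ?_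
    simp only [Nat.cast_ofNat, Nat.add_one_sub_one, pow_one, mul_one]
    ring
  have h3 := (convex_uIcc 0 s).norm_image_sub_le_of_norm_hasDerivWithin_le (C := ε / 2 * |s|)
    (fun x _ => (hd x).hasDerivWithinAt) (fun x hx => ?_) Set.left_mem_uIcc Set.right_mem_uIcc
  · rw [dist_eq_norm]
    have hsC : (s : ℂ) ≠ 0 := by simpa using hs0
    have e : (m s - m 0 - s * n 0) / (s : ℂ) ^ 2 - p / 2 =
        (m s - s * n 0 - s ^ 2 * (p / 2) - (m 0 - (0 : ℝ) * n 0 - ((0 : ℝ) : ℂ) ^ 2 * (p / 2))) /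
          (s : ℂ) ^ 2 := by
      field_simp
      push_cast
      ring
    rw [e, norm_div, norm_pow, Complex.norm_real, Real.norm_eq_abs]
    have hs2 : 0 < |s| ^ 2 := by have := abs_pos.2 hs0; positivity
    rw [sub_zero, Real.norm_eq_abs, mul_assoc, ← sq] at h3
    rw [div_lt_iff₀ hs2]
    refine h3.trans_lt ?_
    exact mul_lt_mul_of_pos_right (half_lt_self hε) hs2
  · have hxs := Set.abs_sub_left_of_mem_uIcc hx
    rw [sub_zero, sub_zero] at hxs
    have := hball (y := x) (by
      rw [dist_zero_right, Real.norm_eq_abs]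
      rw [dist_zero_right, Real.norm_eq_abs] at hs
      exact hxs.trans_lt hs)
    rw [sub_zero, Complex.real_smul, Real.norm_eq_abs] at this
    refine this.trans ?_
    gcongr

variable {μ : Measure ℝ} {T : ℝ → WeakStarLinf μ →L[ℂ] WeakStarLinf μ}

namespace IsAveragingGroup

/-- On the domain of `A²` the orbits of `T` have a second-order Taylor expansion at `0`. Averaged
against the heat kernel, its linear term vanishes and its quadratic term contributes `t A²φ`. -/
theorem negSqGraph_le_generatorGraph [SigmaFinite μ] (hT : IsAveragingGroup T) :
    negSqGraph T ≤ generatorGraph (heatSemigroup T) := by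
  rintro ⟨φ, η⟩ ⟨ξ, h1, h2⟩
  refine mem_generatorGraph_of_hasDerivWithinAt heatSemigroup_zero fun ψ => ?_
  set m : ℝ → ℂ := fun s => evalAt ψ (T s φ) with hm
  set n : ℝ → ℂ := fun s => -evalAt ψ (T s ξ) with hn
  set p : ℝ → ℂ := fun s => -evalAt ψ (T s η) with hp
  have hmd : ∀ t, HasDerivAt m (n t) t := hT.hasDerivAt h1 ψ
  have hnd : ∀ t, HasDerivAt n (p t) t := fun t => by
    refine (hT.hasDerivAt h2 ψ t).neg.congr_deriv ?_
    simp [hp]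
  have hmc : Continuous m := hT.continuous_evalAt φ ψ
  set M := ‖toLinf η‖ * ‖ψ‖
  have hpM : ∀ t, ‖p t‖ ≤ M := fun t => by
    rw [hp]; simp only [norm_neg]; exact hT.norm_evalAt_le η ψ t
  have hm0 : m 0 = evalAt ψ φ := by simp [hm, hT.zero]
  have hp0 : p 0 = -evalAt ψ η := by simp [hp, hT.zero]
  have hone : (0 : ℝ) < ((1 : ℝ) : ℂ).re := by simp
  rw [hasDerivWithinAt_iff_tendsto_slope' (by simp)]
  have hlim : Tendsto (fun t : ℝ => ∫ r : ℝ, heatKernel (1 : ℝ) r *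
      (((m (Real.sqrt t * r) - m 0 - (Real.sqrt t * r : ℝ) * n 0)) / t)) (𝓝[>] 0)
      (𝓝 (∫ r : ℝ, heatKernel (1 : ℝ) r * ((r : ℂ) ^ 2 * (p 0 / 2)))) := by
    refine tendsto_integral_filter_of_dominated_convergence
      (fun r => ‖heatKernel (1 : ℝ) r * (r : ℂ) ^ 2‖ * M) ?_ ?_
      ((integrable_heatKernel_mul_pow hone 2).norm.mul_const M) ?_
    · refine Eventually.of_forall fun t => ?_
      refine (integrable_heatKernel hone).aestronglyMeasurable.mul ?_
      exact Continuous.aestronglyMeasurable (by fun_prop)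
    · filter_upwards [self_mem_nhdsWithin] with t ht
      have ht0 : (0 : ℝ) < t := ht
      refine ae_of_all _ fun r => ?_
      rw [norm_mul, norm_mul, mul_assoc, norm_div, norm_pow, Complex.norm_real, Complex.norm_real,
        Real.norm_eq_abs, Real.norm_eq_abs, sq_abs, abs_of_pos ht0]
      gcongr
      rw [div_le_iff₀ ht0]
      refine (norm_taylor_two_le hmd hnd hpM (Real.sqrt t * r)).trans_eq ?_
      rw [mul_pow, Real.sq_sqrt ht0.le]
      ring
    · refine ae_of_all _ fun r => ?_
      refine Tendsto.const_mul _ ?_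
      rcases eq_or_ne r 0 with rfl | hr
      · simp only [mul_zero, sub_self, Complex.ofReal_zero, zero_mul, zero_div, ne_eq,
          OfNat.ofNat_ne_zero, not_false_eq_true, zero_pow]
        exact tendsto_const_nhds
      have h3 : Tendsto (fun t : ℝ => Real.sqrt t * r) (𝓝[>] 0) (𝓝[≠] 0) := by
        refine tendsto_nhdsWithin_iff.2 ⟨?_, ?_⟩
        · exact ((by fun_prop : Continuous fun t : ℝ => Real.sqrt t * r).tendsto' 0 0
            (by simp)).mono_left nhdsWithin_le_nhds
        · filter_upwards [self_mem_nhdsWithin] with t ht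
          exact mul_ne_zero (Real.sqrt_pos.2 ht).ne' hr
      have h4 := ((tendsto_taylor_two hmd (hnd 0)).comp h3).const_mul ((r : ℂ) ^ 2)
      refine h4.congr' ?_
      filter_upwards [self_mem_nhdsWithin] with t ht
      have ht0 : (0 : ℝ) < t := ht
      have htC : (t : ℂ) ≠ 0 := by simpa using ht0.ne'
      have hrC : (r : ℂ) ≠ 0 := by simpa using hr
      have hs : (Real.sqrt t : ℂ) ^ 2 = t := by
        rw [← Complex.ofReal_pow, Real.sq_sqrt ht0.le]
      simp only [Function.comp]
      rw [show (((Real.sqrt t * r : ℝ) : ℂ)) ^ 2 = t * (r : ℂ) ^ 2 by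
        rw [Complex.ofReal_mul, mul_pow, hs]]
      field_simp
  have hval : ∫ r : ℝ, heatKernel (1 : ℝ) r * ((r : ℂ) ^ 2 * (p 0 / 2)) = -evalAt ψ η := by
    simp_rw [← mul_assoc]
    rw [integral_mul_const, integral_heatKernel_one_mul_sq, hp0]
    ring
  rw [hval] at hlim
  refine hlim.congr' ?_
  filter_upwards [self_mem_nhdsWithin] with t ht
  have ht0 : (0 : ℝ) < t := ht
  have htC : (t : ℂ) ≠ 0 := by simpa using ht0.ne'
  have hi : Integrable fun r : ℝ => heatKernel (1 : ℝ) r * m (Real.sqrt t * r) :=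
    (integrable_heatKernel hone).mul_bdd (hmc.comp (by fun_prop)).aestronglyMeasurable
      (ae_of_all _ fun r => hT.norm_evalAt_le φ ψ _)
  have hS : evalAt ψ (heatSemigroup T t φ) =
      ∫ r : ℝ, heatKernel (1 : ℝ) r * m (Real.sqrt t * r) := by
    rw [heatSemigroup_of_pos ht0, hT.evalAt_heatOp_scaled (by simpa using ht0)
      (Real.sqrt_pos.2 ht0)]
    simp_rw [sqrt_mul_heatKernel ht0]
    rfl
  have hi1 := (integrable_heatKernel_mul_pow hone 1).mul_const ((Real.sqrt t : ℂ) * n 0)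
  have hi0 := (integrable_heatKernel hone).mul_const (m 0)
  have e : ∀ r : ℝ, heatKernel (1 : ℝ) r *
      (((m (Real.sqrt t * r) - m 0 - (Real.sqrt t * r : ℝ) * n 0)) / t) =
      (t : ℂ)⁻¹ * (heatKernel (1 : ℝ) r * m (Real.sqrt t * r) - heatKernel (1 : ℝ) r * m 0 -
        heatKernel (1 : ℝ) r * (r : ℂ) ^ 1 * ((Real.sqrt t : ℂ) * n 0)) := fun r => by
    push_cast
    ring
  simp_rw [e]
  have hi2 : Integrable fun r : ℝ => heatKernel (1 : ℝ) r * m (Real.sqrt t * r) -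
    heatKernel (1 : ℝ) r * m 0 := hi.sub hi0
  rw [integral_const_mul, integral_sub hi2 hi1, integral_sub hi hi0, integral_mul_const,
    integral_mul_const]
  simp_rw [pow_one]
  rw [integral_heatKernel hone, integral_heatKernel_mul_id, ← hS]
  simp only [slope, vsub_eq_sub, sub_zero, heatSemigroup_zero, ContinuousLinearMap.id_apply,
    Complex.real_smul, Complex.ofReal_inv, hm0]
  ring

theorem generatorGraph_heatSemigroup [SigmaFinite μ] (hT : IsAveragingGroup T) :
    generatorGraph (heatSemigroup T) = negSqGraph T := by
  refine le_antisymm (fun p hp => ?_) hT.negSqGraph_le_generatorGraph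
  set f := p.1 + p.2 with hf
  set φ' := groupResolvent T (groupResolvent (fun t => T (-t)) f) with hφ'
  have h1 : (φ', f - φ') ∈ negSqGraph T := by
    rw [hT.mem_negSqGraph_iff]
    simp [hφ']
  have h2 := (generatorGraph _).sub_mem (hT.negSqGraph_le_generatorGraph h1) hp
  have h3 : φ' - p.1 = 0 := by
    refine eq_zero_of_mem_generatorGraph_neg hT.isWeakStarSemigroup_heatSemigroup
      hT.isContractiveFamily_heatSemigroup ?_
    convert h2 using 1
    ext1
    · rfl
    · simp [hf]
      abel
  rw [hT.mem_negSqGraph_iff]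
  exact sub_eq_zero.1 h3

end IsAveragingGroup

/-- `φ ∈ L_∞` takes real nonnegative values almost everywhere. -/
def IsNonnegLinf (φ : WeakStarLinf μ) : Prop :=
  ∀ᵐ x ∂μ, 0 ≤ (toLinf φ x).re ∧ (toLinf φ x).im = 0

/-- Nonnegativity in `L_∞` can be tested against indicator functions. -/
theorem isNonnegLinf_iff [SigmaFinite μ] {φ : WeakStarLinf μ} : IsNonnegLinf φ ↔
    ∀ s (hs : MeasurableSet s) (hμs : μ s ≠ ⊤),
      0 ≤ (evalAt (indicatorConstLp 1 hs hμs (1 : ℂ)) φ).re ∧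
        (evalAt (indicatorConstLp 1 hs hμs (1 : ℂ)) φ).im = 0 := by
  have hint : ∀ s, MeasurableSet s → μ s < ⊤ → IntegrableOn (toLinf φ) s μ := fun s _ hμs =>
    Measure.integrableOn_of_bounded hμs.ne (Lp.aestronglyMeasurable _)
      (ae_restrict_of_ae (ae_norm_le_norm _))
  have hre : ∀ s, MeasurableSet s → μ s < ⊤ →
      (∫ x in s, toLinf φ x ∂μ).re = ∫ x in s, (toLinf φ x).re ∂μ := fun s hs hμs =>
    (integral_re (hint s hs hμs)).symm
  have him : ∀ s, MeasurableSet s → μ s < ⊤ →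
      (∫ x in s, toLinf φ x ∂μ).im = ∫ x in s, (toLinf φ x).im ∂μ := fun s hs hμs =>
    (integral_im (hint s hs hμs)).symm
  constructor
  · intro h s hs hμs
    rw [evalAt_indicator, hre s hs hμs.lt_top, him s hs hμs.lt_top]
    refine ⟨integral_nonneg_of_ae (ae_restrict_of_ae (h.mono fun x hx => hx.1)), ?_⟩
    rw [integral_congr_ae (ae_restrict_of_ae (h.mono fun x hx => hx.2))]
    simp
  · intro h
    have h1 : 0 ≤ᵐ[μ] fun x => (toLinf φ x).re := by
      refine ae_nonneg_of_forall_setIntegral_nonneg_of_sigmaFinite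
        (fun s hs hμs => (hint s hs hμs).re) fun s hs hμs => ?_
      have := (h s hs hμs.ne).1
      rwa [evalAt_indicator, hre s hs hμs] at this
    have h2 : (fun x => (toLinf φ x).im) =ᵐ[μ] 0 := by
      refine ae_eq_zero_of_forall_setIntegral_eq_of_sigmaFinite
        (fun s hs hμs => (hint s hs hμs).im) fun s hs hμs => ?_
      have := (h s hs hμs.ne).2
      rwa [evalAt_indicator, him s hs hμs] at this
    filter_upwards [h1, h2] with x hx1 hx2
    exact ⟨hx1, hx2⟩

theorem IsAveragingGroup.isPositiveFamily_heatSemigroup [SigmaFinite μ] (hT : IsAveragingGroup T)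
    (hpos : ∀ t φ, IsNonnegLinf φ → IsNonnegLinf (T t φ)) :
    IsPositiveFamily (heatSemigroup T) := by
  intro t ht φ hφ
  rcases ht.eq_or_lt with rfl | ht
  · rw [heatSemigroup_zero]; exact hφ
  rw [heatSemigroup_of_pos ht]
  change IsNonnegLinf _
  rw [isNonnegLinf_iff]
  intro s hs hμs
  have hi := hT.integrable_mul_evalAt (integrable_heatKernel (z := t) (by simpa using ht)) φ
    (indicatorConstLp 1 hs hμs (1 : ℂ))
  rw [heatOp, hT.evalAt_groupAverage (integrable_heatKernel (by simpa using ht))]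
  have h1 : ∀ r, 0 ≤ (heatKernel t r * evalAt (indicatorConstLp 1 hs hμs (1 : ℂ)) (T r φ)).re ∧
      (heatKernel t r * evalAt (indicatorConstLp 1 hs hμs (1 : ℂ)) (T r φ)).im = 0 := by
    intro r
    obtain ⟨h2, h3⟩ := isNonnegLinf_iff.1 (hpos r φ hφ) s hs hμs
    rw [heatKernel_ofReal ht, Complex.re_ofReal_mul, Complex.im_ofReal_mul, h3, mul_zero]
    exact ⟨mul_nonneg (by positivity) h2, rfl⟩
  constructor
  · have := integral_re hi
    simp only [RCLike.re_to_complex] at this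
    rw [← this]
    exact integral_nonneg fun r => (h1 r).1
  · have := integral_im hi
    simp only [RCLike.im_to_complex] at this
    rw [← this]
    simp [(h1 _).2]

end HeatGenerator

/-! ### Composition operators on `L_∞` -/

section Composition

variable {μ ν : Measure ℝ}

theorem memLp_top_comp {e : ℝ → ℝ} (h : Measure.QuasiMeasurePreserving e μ ν) (φ : Lp ℂ ⊤ ν) :
    MemLp (φ ∘ e) ⊤ μ :=
  memLp_top_of_bound ((Lp.aestronglyMeasurable φ).comp_quasiMeasurePreserving h) ‖φ‖
    (h.ae (ae_norm_le_norm φ))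

/-- The linear map `φ ↦ φ ∘ e` from `L_∞(ν)` to `L_∞(μ)`. -/
def compLinfₗ (e : ℝ → ℝ) (h : Measure.QuasiMeasurePreserving e μ ν) :
    WeakStarLinf ν →ₗ[ℂ] WeakStarLinf μ where
  toFun φ := toLinf.symm ((memLp_top_comp h (toLinf φ)).toLp _)
  map_add' φ φ' := by
    rw [← map_add]
    refine congrArg toLinf.symm (Lp.ext ?_)
    filter_upwards [(memLp_top_comp h (toLinf (φ + φ'))).coeFn_toLp,
      (memLp_top_comp h (toLinf φ)).coeFn_toLp, (memLp_top_comp h (toLinf φ')).coeFn_toLp,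
      Lp.coeFn_add ((memLp_top_comp h (toLinf φ)).toLp _) ((memLp_top_comp h (toLinf φ')).toLp _),
      h.ae (Lp.coeFn_add (toLinf φ) (toLinf φ'))] with x h1 h2 h3 h4 h5
    rw [h1, h4, Pi.add_apply, h2, h3, Function.comp, map_add, h5]
    rfl
  map_smul' c φ := by
    rw [← map_smul]
    refine congrArg toLinf.symm (Lp.ext ?_)
    filter_upwards [(memLp_top_comp h (toLinf (c • φ))).coeFn_toLp,
      (memLp_top_comp h (toLinf φ)).coeFn_toLp,
      Lp.coeFn_smul (RingHom.id ℂ c) ((memLp_top_comp h (toLinf φ)).toLp _),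
      h.ae (Lp.coeFn_smul c (toLinf φ))] with x h1 h2 h4 h5
    rw [h1, h4, Pi.smul_apply, h2, Function.comp, map_smul, h5]
    rfl

/-- The weak* continuous operator `φ ↦ φ ∘ e` from `L_∞(ν)` to `L_∞(μ)`. Its pre-adjoint transports
`ψ μ` along `e` and takes the Radon–Nikodym derivative with respect to `ν`. -/
def compLinf [SigmaFinite μ] [SigmaFinite ν] (e : ℝ ≃ᵐ ℝ)
    (h : Measure.QuasiMeasurePreserving e μ ν) : WeakStarLinf ν →L[ℂ] WeakStarLinf μ :=
  weakStarMapOfAdjoint (compLinfₗ e h) fun ψ => by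
    have : SigmaFinite (μ.map e) := e.sigmaFinite_map
    have hψ : Integrable ψ μ := L1.integrable_coeFn ψ
    have hi : Integrable (fun y => ((μ.map e).rnDeriv ν y).toReal • ψ (e.symm y)) ν := by
      rw [integrable_rnDeriv_smul_iff h.absolutelyContinuous, integrable_map_equiv]
      refine hψ.congr (ae_of_all _ fun x => ?_)
      simp
    refine ⟨hi.toL1 _, fun φ => ?_⟩
    rw [evalAt_apply, evalAt_apply]
    calc ∫ x, toLinf (compLinfₗ e h φ) x * ψ x ∂μ
        = ∫ x, (fun y => toLinf φ y * ψ (e.symm y)) (e x) ∂μ := by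
          refine integral_congr_ae ?_
          filter_upwards [(memLp_top_comp h (toLinf φ)).coeFn_toLp] with x hx
          have : toLinf (compLinfₗ e h φ) x = ((memLp_top_comp h (toLinf φ)).toLp _) x := rfl
          rw [this, hx]
          simp
      _ = ∫ y, toLinf φ y * ψ (e.symm y) ∂(μ.map e) := 
          (integral_map_equiv e fun y => toLinf φ y * ψ (e.symm y)).symm
      _ = ∫ y, ((μ.map e).rnDeriv ν y).toReal • (toLinf φ y * ψ (e.symm y)) ∂ν :=
          (integral_rnDeriv_smul h.absolutelyContinuous).symm
      _ = _ := by
          refine integral_congr_ae ?_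
          filter_upwards [hi.coeFn_toL1] with y hy
          rw [hy, mul_smul_comm]

theorem weakStar_ext_ae {φ φ' : WeakStarLinf μ} (h : toLinf φ =ᵐ[μ] toLinf φ') : φ = φ' :=
  toLinf.injective (Lp.ext h)

/-- An averaging group stays one when conjugated by norm-decreasing weak* isomorphisms. -/
theorem IsAveragingGroup.conj {T : ℝ → WeakStarLinf ν →L[ℂ] WeakStarLinf ν}
    (hT : IsAveragingGroup T) (J : WeakStarLinf μ →L[ℂ] WeakStarLinf ν)
    (J' : WeakStarLinf ν →L[ℂ] WeakStarLinf μ) (h : ∀ φ, J' (J φ) = φ) (h' : ∀ φ, J (J' φ) = φ)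
    (hJ : ∀ φ, ‖toLinf (J φ)‖ ≤ ‖toLinf φ‖) (hJ' : ∀ φ, ‖toLinf (J' φ)‖ ≤ ‖toLinf φ‖) :
    IsAveragingGroup fun t => J'.comp ((T t).comp J) where
  zero := by
    ext φ
    simp [hT.zero, h]
  add s t := by
    ext φ
    simp [hT.add, h']
  continuous φ := J'.continuous.comp (hT.continuous (J φ))
  norm_le t φ := (hJ' _).trans ((hT.norm_le t _).trans (hJ φ))
  exists_average k hk := by
    obtain ⟨K, h1, h2⟩ := hT.exists_average k hk
    refine ⟨J'.comp (K.comp J), fun φ ψ => ?_, fun φ => ?_⟩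
    · obtain ⟨ψ', hψ'⟩ := LinearMap.dualEmbedding_surjective (linfPairing ν) ((evalAt ψ).comp J')
      have e : ∀ φ, evalAt ψ (J' φ) = evalAt ψ' φ := fun φ =>
        (congrArg (fun L => L φ) hψ').symm
      simp only [ContinuousLinearMap.comp_apply, e, h1]
    · refine (hJ' _).trans ((h2 (J φ)).trans ?_)
      exact mul_le_mul_of_nonneg_left (hJ φ) (integral_nonneg fun _ => norm_nonneg _)

variable [SigmaFinite μ] [SigmaFinite ν]

theorem compLinf_ae_eq (e : ℝ ≃ᵐ ℝ) (h : Measure.QuasiMeasurePreserving e μ ν)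
    (φ : WeakStarLinf ν) : toLinf (compLinf e h φ) =ᵐ[μ] fun x => toLinf φ (e x) :=
  (memLp_top_comp h (toLinf φ)).coeFn_toLp

theorem norm_compLinf_le (e : ℝ ≃ᵐ ℝ) (h : Measure.QuasiMeasurePreserving e μ ν)
    (φ : WeakStarLinf ν) : ‖toLinf (compLinf e h φ)‖ ≤ ‖toLinf φ‖ := by
  refine norm_le_of_ae_norm_le _ (norm_nonneg _) ?_
  filter_upwards [compLinf_ae_eq e h φ, h.ae (ae_norm_le_norm (toLinf φ))] with x h1 h2
  rwa [h1]

theorem compLinf_nonneg (e : ℝ ≃ᵐ ℝ) (h : Measure.QuasiMeasurePreserving e μ ν)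
    {φ : WeakStarLinf ν} (hφ : IsNonnegLinf φ) : IsNonnegLinf (compLinf e h φ) := by
  filter_upwards [compLinf_ae_eq e h φ, h.ae hφ] with x h1 h2
  rwa [h1]

end Composition

/-! ### Translations on Lebesgue space -/

section Translation

theorem measurePreserving_addRight (t : ℝ) :
    MeasurePreserving (MeasurableEquiv.addRight t) (volume : Measure ℝ) volume :=
  measurePreserving_add_right volume t

/-- The translation `φ ↦ φ(· - t)` on `L_∞(dx)`. -/
def translation (t : ℝ) : WeakStarLinf (volume : Measure ℝ) →L[ℂ] WeakStarLinf volume :=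
  compLinf (MeasurableEquiv.addRight (-t))
    (measurePreserving_addRight (-t)).quasiMeasurePreserving

theorem translation_ae_eq (t : ℝ) (φ : WeakStarLinf (volume : Measure ℝ)) :
    toLinf (translation t φ) =ᵐ[volume] fun x => toLinf φ (x - t) := by
  simpa only [sub_eq_add_neg] using! compLinf_ae_eq (MeasurableEquiv.addRight (-t))
    (measurePreserving_addRight (-t)).quasiMeasurePreserving φ

/-- The translation `ψ ↦ ψ(· + t)` on `L_1(dx)`, pre-adjoint to `translation t`. -/
def translationL1 (t : ℝ) (ψ : Lp ℂ 1 (volume : Measure ℝ)) : Lp ℂ 1 (volume : Measure ℝ) :=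
  Lp.compMeasurePreserving (fun x => x + t) (measurePreserving_add_right volume t) ψ

theorem continuous_translationL1 (ψ : Lp ℂ 1 (volume : Measure ℝ)) :
    Continuous fun t => translationL1 t ψ := by
  have hc : Continuous fun t : ℝ => (⟨fun x => x + t, by fun_prop⟩ : C(ℝ, ℝ)) :=
    ContinuousMap.continuous_of_continuous_uncurry _ (
      (continuous_snd.add continuous_fst))
  exact Continuous.compMeasurePreservingLp (Z := ℝ) (p := 1)
    (g := fun t : ℝ => (⟨fun x => x + t, by fun_prop⟩ : C(ℝ, ℝ)))
    (f := fun _ => ψ) continuous_const hc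
    (fun t => measurePreserving_add_right volume t) ENNReal.one_ne_top

theorem evalAt_translation (t : ℝ) (φ : WeakStarLinf (volume : Measure ℝ)) (ψ : Lp ℂ 1 volume) :
    evalAt ψ (translation t φ) = evalAt (translationL1 t ψ) φ := by
  rw [evalAt_apply, evalAt_apply, ← integral_add_right_eq_self _ t]
  refine integral_congr_ae ?_
  filter_upwards [(measurePreserving_add_right volume t).quasiMeasurePreserving.ae
    (translation_ae_eq t φ), Lp.coeFn_compMeasurePreserving ψ (measurePreserving_add_right volume t)]
    with x h1 h2
  rw [h1, add_sub_cancel_right]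
  congr 1
  exact h2.symm

theorem isWeakStarGroup_translation : IsWeakStarGroup translation where
  zero := by
    ext φ
    refine weakStar_ext_ae ((translation_ae_eq 0 φ).trans (ae_of_all _ fun x => ?_))
    simp
  add s t := by
    ext φ
    refine weakStar_ext_ae ?_
    have h1 := (measurePreserving_addRight (-s)).quasiMeasurePreserving.ae (translation_ae_eq t φ)
    filter_upwards [translation_ae_eq (s + t) φ, translation_ae_eq s (translation t φ), h1]
      with x h1 h2 h3
    rw [h1, ContinuousLinearMap.comp_apply, h2, sub_eq_add_neg x s]
    rw [show x + -s = MeasurableEquiv.addRight (-s) x from rfl, h3]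
    congr 1
    change x - (s + t) = x + -s - t
    ring
  continuous φ := by
    refine continuous_weakStar fun ψ => ?_
    simp_rw [evalAt_translation]
    exact ((ContinuousLinearMap.mul ℂ ℂ).lpPairing volume ⊤ 1 (toLinf φ)).continuous.comp
      (continuous_translationL1 ψ)

section Convolution

variable {k : ℝ → ℂ}

theorem aestronglyMeasurable_mul_translate (hk : Integrable k) (φ : Lp ℂ ⊤ (volume : Measure ℝ)) :
    AEStronglyMeasurable (fun p : ℝ × ℝ => k p.2 * φ (p.1 - p.2)) (volume.prod volume) :=
  hk.aestronglyMeasurable.convolution_integrand (ContinuousLinearMap.mul ℂ ℂ)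
    (Lp.aestronglyMeasurable φ)

theorem ae_norm_sub_le (φ : Lp ℂ ⊤ (volume : Measure ℝ)) (x : ℝ) :
    ∀ᵐ s : ℝ, ‖φ (x - s)‖ ≤ ‖φ‖ :=
  (quasiMeasurePreserving_sub_left_of_right_invariant volume x).ae (ae_norm_le_norm φ)

theorem norm_convolution_linf_le (hk : Integrable k) (φ : Lp ℂ ⊤ (volume : Measure ℝ)) (x : ℝ) :
    ‖∫ s, k s * φ (x - s)‖ ≤ (∫ s, ‖k s‖) * ‖φ‖ := by
  rw [← integral_mul_const]
  refine norm_integral_le_of_norm_le (hk.norm.mul_const _) ?_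
  filter_upwards [ae_norm_sub_le φ x] with s hs
  rw [norm_mul]
  gcongr

theorem memLp_convolution_linf (hk : Integrable k) (φ : Lp ℂ ⊤ (volume : Measure ℝ)) :
    MemLp (fun x => ∫ s, k s * φ (x - s)) ⊤ volume :=
  memLp_top_of_bound (aestronglyMeasurable_mul_translate hk φ).integral_prod_right' _
    (ae_of_all _ (norm_convolution_linf_le hk φ))

/-- Fubini's theorem for the convolution of `k ∈ L_1` and `φ ∈ L_∞`, paired with `ψ ∈ L_1`. -/
theorem evalAt_convolution (hk : Integrable k) (φ : WeakStarLinf (volume : Measure ℝ))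
    (ψ : Lp ℂ 1 volume) :
    evalAt ψ (toLinf.symm ((memLp_convolution_linf hk (toLinf φ)).toLp _)) =
      ∫ s, k s * evalAt ψ (translation s φ) := by
  have hψ : Integrable ψ volume := L1.integrable_coeFn ψ
  have e1 : ∀ s, k s * evalAt ψ (translation s φ) =
      ∫ x, k s * toLinf φ (x - s) * ψ x := by
    intro s
    rw [evalAt_apply, ← integral_const_mul]
    refine integral_congr_ae ?_
    filter_upwards [translation_ae_eq s φ] with x hx
    rw [hx, mul_assoc]
  have e2 : evalAt ψ (toLinf.symm ((memLp_convolution_linf hk (toLinf φ)).toLp _)) =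
      ∫ x, ∫ s, k s * toLinf φ (x - s) * ψ x := by
    rw [evalAt_apply]
    refine integral_congr_ae ?_
    filter_upwards [(memLp_convolution_linf hk (toLinf φ)).coeFn_toLp] with x hx
    rw [LinearEquiv.apply_symm_apply, hx, integral_mul_const]
  simp_rw [e1]
  rw [e2]
  refine integral_integral_swap ?_
  have hm := (aestronglyMeasurable_mul_translate hk (toLinf φ)).mul
    (hψ.aestronglyMeasurable.comp_quasiMeasurePreserving
      (Measure.quasiMeasurePreserving_fst (μ := volume) (ν := (volume : Measure ℝ))))
  refine ((hψ.norm.mul_prod hk.norm).mul_const ‖toLinf φ‖).mono' hm ?_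
  have hb : ∀ᵐ p : ℝ × ℝ ∂(volume.prod volume), ‖toLinf φ (p.1 - p.2)‖ ≤ ‖toLinf φ‖ :=
    (quasiMeasurePreserving_sub_of_right_invariant volume volume).ae (ae_norm_le_norm (toLinf φ))
  filter_upwards [hb] with p hp
  simp only [Function.uncurry, norm_mul]
  calc ‖k p.2‖ * ‖toLinf φ (p.1 - p.2)‖ * ‖ψ p.1‖ ≤ ‖k p.2‖ * ‖toLinf φ‖ * ‖ψ p.1‖ := by gcongr
    _ = ‖ψ p.1‖ * ‖k p.2‖ * ‖toLinf φ‖ := by ring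

end Convolution

theorem isAveragingGroup_translation : IsAveragingGroup translation where
  toIsWeakStarGroup := isWeakStarGroup_translation
  norm_le t φ := norm_compLinf_le _ _ φ
  exists_average k hk := by
    have hlin : ∀ φ ψ, evalAt ψ (toLinf.symm ((memLp_convolution_linf hk (toLinf φ)).toLp _)) =
        ∫ s, k s * evalAt ψ (translation s φ) := evalAt_convolution hk
    have hi : ∀ (φ : WeakStarLinf (volume : Measure ℝ)) ψ,
        Integrable fun s => k s * evalAt ψ (translation s φ) := fun φ ψ =>
      hk.mul_bdd ((evalAt ψ).continuous.comp
        (isWeakStarGroup_translation.continuous φ)).aestronglyMeasurable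
        (ae_of_all _ fun s => (norm_evalAt_le ψ _).trans
          (mul_le_mul_of_nonneg_right (norm_compLinf_le _ _ φ) (norm_nonneg ψ)))
    let K : WeakStarLinf (volume : Measure ℝ) →ₗ[ℂ] WeakStarLinf volume :=
      { toFun := fun φ => toLinf.symm ((memLp_convolution_linf hk (toLinf φ)).toLp _)
        map_add' := fun φ φ' => weakStar_ext fun ψ => by
          rw [map_add (evalAt ψ), hlin, hlin, hlin, ← integral_add (hi φ ψ) (hi φ' ψ)]
          simp only [map_add, mul_add]
        map_smul' := fun c φ => weakStar_ext fun ψ => by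
          rw [map_smul (evalAt ψ), hlin, hlin, smul_eq_mul, ← integral_const_mul]
          simp only [map_smul, smul_eq_mul, RingHom.id_apply]
          refine integral_congr_ae (ae_of_all _ fun s => ?_)
          simp only []
          ring }
    have hK : ∀ φ ψ, evalAt ψ (K φ) = ∫ s, k s * evalAt ψ (translation s φ) := hlin
    refine ⟨weakStarMapOfAdjoint K fun ψ => ?_, hK, fun φ => ?_⟩
    · have hψi : Integrable fun s => k s • translationL1 s ψ := by
        refine hk.smul_bdd ‖ψ‖ (continuous_translationL1 ψ).aestronglyMeasurable
          (ae_of_all _ fun s => ?_)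
        exact (Lp.norm_compMeasurePreserving ψ (measurePreserving_add_right volume s)).le
      refine ⟨∫ s, k s • translationL1 s ψ, fun φ => ?_⟩
      have := ((ContinuousLinearMap.mul ℂ ℂ).lpPairing volume ⊤ 1 (toLinf φ)).integral_comp_comm hψi
      refine (hK φ ψ).trans (Eq.trans ?_ this)
      refine integral_congr_ae (ae_of_all _ fun s => ?_)
      simp only [evalAt_translation, map_smul, smul_eq_mul]
      rfl
    · refine norm_le_of_ae_norm_le _ (by positivity) ?_
      filter_upwards [(memLp_convolution_linf hk (toLinf φ)).coeFn_toLp] with x hx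
      have : toLinf (K φ) x = ((memLp_convolution_linf hk (toLinf φ)).toLp _) x := rfl
      change ‖toLinf (K φ) x‖ ≤ _
      rw [this, hx]
      exact norm_convolution_linf_le hk (toLinf φ) x

end Translation

/-! ### The flow of a complete vector field on the line -/

section Flow

/-- A homeomorphism `e` of the line that straightens the vector field `a d/dx` to `d/dx`. -/
structure IsStraightening (a : ℝ → ℝ) (e : ℝ ≃ₜ ℝ) : Prop where
  hasDerivAt : ∀ x, HasDerivAt e (a x)⁻¹ x
  hasDerivAt_symm : ∀ x, HasDerivAt e.symm (a (e.symm x)) x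

/-- The coordinate `∫_0^x a⁻¹` straightens `a d/dx`; it is onto because both integrals diverge. -/
theorem exists_isStraightening {a : ℝ → ℝ} (ha : ∀ x, 0 < a x) (hac : Continuous a)
    (ha_top : Tendsto (fun r : ℝ => ∫ x in (0 : ℝ)..r, (a x)⁻¹) atTop atTop)
    (ha_bot : Tendsto (fun r : ℝ => ∫ x in r..(0 : ℝ), (a x)⁻¹) atBot atTop) :
    ∃ e : ℝ ≃ₜ ℝ, IsStraightening a e := by
  set F : ℝ → ℝ := fun r => ∫ x in (0 : ℝ)..r, (a x)⁻¹ with hF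
  have hinv : Continuous fun x => (a x)⁻¹ := hac.inv₀ fun x => (ha x).ne'
  have hd : ∀ x, HasDerivAt F (a x)⁻¹ x := fun x =>
    (hinv.integral_hasStrictDerivAt 0 x).hasDerivAt
  have hmono : StrictMono F := strictMono_of_deriv_pos fun x => by
    rw [(hd x).deriv]; exact inv_pos.2 (ha x)
  have hcont : Continuous F := continuous_iff_continuousAt.2 fun x => (hd x).continuousAt
  have hbot : Tendsto F atBot atBot := by
    have := tendsto_neg_atTop_atBot.comp ha_bot
    refine this.congr fun r => ?_
    rw [Function.comp, hF, ← intervalIntegral.integral_symm]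
  have hsurj : Function.Surjective F := hcont.surjective ha_top hbot
  let e : ℝ ≃ₜ ℝ := (hmono.orderIsoOfSurjective F hsurj).toHomeomorph
  have he : ∀ x, e x = F x := fun _ => rfl
  refine ⟨e, fun x => hd x, fun x => ?_⟩
  have h1 := HasDerivAt.of_local_left_inverse (f := F) (g := e.symm) (a := x)
    e.symm.continuous.continuousAt (hd (e.symm x)) (inv_ne_zero (ha _).ne')
    (Eventually.of_forall fun y => by rw [← he, e.apply_symm_apply])
  simpa using h1

theorem quasiMeasurePreserving_of_differentiable_symm (f : ℝ ≃ₜ ℝ) (hf : Differentiable ℝ f.symm) :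
    Measure.QuasiMeasurePreserving f volume volume := by
  refine ⟨f.continuous.measurable, Measure.AbsolutelyContinuous.mk fun s hs h0 => ?_⟩
  rw [Measure.map_apply f.continuous.measurable hs, ← f.image_symm]
  exact addHaar_image_eq_zero_of_differentiableOn_of_addHaar_eq_zero volume hf.differentiableOn h0

variable {a : ℝ → ℝ} {e : ℝ ≃ₜ ℝ} {ρ : ℝ → ℝ}

/-- The flow in the straightening coordinate is translation. -/
def flowOf (e : ℝ ≃ₜ ℝ) (t : ℝ) : ℝ ≃ₜ ℝ := (e.trans (Homeomorph.addRight t)).trans e.symm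

theorem flowOf_apply (e : ℝ ≃ₜ ℝ) (t x : ℝ) : flowOf e t x = e.symm (e x + t) := rfl

theorem IsStraightening.hasDerivAt_flowOf_time (he : IsStraightening a e) (t x : ℝ) :
    HasDerivAt (fun s => flowOf e s x) (a (flowOf e t x)) t := by
  simpa using! (he.hasDerivAt_symm (e x + t)).comp t ((hasDerivAt_id t).const_add (e x))

theorem IsStraightening.isFlow (he : IsStraightening a e) : IsFlow a fun t => flowOf e t where
  initial x := by simp [flowOf_apply]
  ode := he.hasDerivAt_flowOf_time

theorem IsStraightening.hasDerivAt_flowOf (he : IsStraightening a e) (t x : ℝ) :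
    HasDerivAt (flowOf e t) (a (flowOf e t x) * (a x)⁻¹) x :=
  HasDerivAt.comp (h₂ := e.symm) (h := fun x => e x + t) x (he.hasDerivAt_symm (e x + t))
    ((he.hasDerivAt x).add_const t)

instance (ρ : ℝ → ℝ) : SigmaFinite (weightedMeasure ρ) := by
  unfold weightedMeasure
  infer_instance

theorem weightedMeasure_absolutelyContinuous (ρ : ℝ → ℝ) : weightedMeasure ρ ≪ volume :=
  withDensity_absolutelyContinuous _ _

theorem IsStraightening.quasiMeasurePreserving (he : IsStraightening a e) (ρ : ℝ → ℝ) :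
    Measure.QuasiMeasurePreserving e.toMeasurableEquiv (weightedMeasure ρ) volume :=
  (quasiMeasurePreserving_of_differentiable_symm e
    fun x => (he.hasDerivAt_symm x).differentiableAt).mono_left
    (weightedMeasure_absolutelyContinuous ρ)

theorem IsStraightening.quasiMeasurePreserving_symm (he : IsStraightening a e)
    (hρ : volume ≪ weightedMeasure ρ) :
    Measure.QuasiMeasurePreserving e.symm.toMeasurableEquiv volume (weightedMeasure ρ) :=
  (quasiMeasurePreserving_of_differentiable_symm e.symm
    fun x => (he.hasDerivAt x).differentiableAt).mono_right hρ

theorem IsStraightening.quasiMeasurePreserving_flowOf (he : IsStraightening a e) (t : ℝ)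
    (hρ : volume ≪ weightedMeasure ρ) :
    Measure.QuasiMeasurePreserving (flowOf e t) (weightedMeasure ρ) (weightedMeasure ρ) :=
  (quasiMeasurePreserving_of_differentiable_symm (flowOf e t)
    fun x => (he.hasDerivAt_flowOf (-t) x).differentiableAt).mono
    (weightedMeasure_absolutelyContinuous ρ) hρ

/-- The group `φ ↦ φ ∘ e^{-tX}` on `L_∞(ρ dx)`, obtained from the translation group on `L_∞(dx)` by
the change of variables `e`. -/
def flowGroup (he : IsStraightening a e) (hρ : volume ≪ weightedMeasure ρ) (t : ℝ) :
    WeakStarLinf (weightedMeasure ρ) →L[ℂ] WeakStarLinf (weightedMeasure ρ) :=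
  (compLinf e.toMeasurableEquiv (he.quasiMeasurePreserving ρ)).comp ((translation t).comp
    (compLinf e.symm.toMeasurableEquiv (he.quasiMeasurePreserving_symm hρ)))

theorem isAveragingGroup_flowGroup (he : IsStraightening a e) (hρ : volume ≪ weightedMeasure ρ) :
    IsAveragingGroup (flowGroup he hρ) := by
  refine isAveragingGroup_translation.conj
    (compLinf e.symm.toMeasurableEquiv (he.quasiMeasurePreserving_symm hρ))
    (compLinf e.toMeasurableEquiv (he.quasiMeasurePreserving ρ)) (fun φ => ?_) (fun φ => ?_)
    (norm_compLinf_le _ _) (norm_compLinf_le _ _)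
  · refine weakStar_ext_ae ?_
    filter_upwards [compLinf_ae_eq e.toMeasurableEquiv (he.quasiMeasurePreserving ρ)
      (compLinf e.symm.toMeasurableEquiv (he.quasiMeasurePreserving_symm hρ) φ),
      (he.quasiMeasurePreserving ρ).ae (compLinf_ae_eq e.symm.toMeasurableEquiv
        (he.quasiMeasurePreserving_symm hρ) φ)] with x h1 h2
    rw [h1, h2]
    simp
  · refine weakStar_ext_ae ?_
    filter_upwards [compLinf_ae_eq e.symm.toMeasurableEquiv (he.quasiMeasurePreserving_symm hρ)
      (compLinf e.toMeasurableEquiv (he.quasiMeasurePreserving ρ) φ),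
      (he.quasiMeasurePreserving_symm hρ).ae (compLinf_ae_eq e.toMeasurableEquiv
        (he.quasiMeasurePreserving ρ) φ)] with x h1 h2
    rw [h1, h2]
    simp

theorem flowGroup_ae_eq (he : IsStraightening a e) (hρ : volume ≪ weightedMeasure ρ) (t : ℝ)
    (φ : WeakStarLinf (weightedMeasure ρ)) :
    toLinf (flowGroup he hρ t φ) =ᵐ[weightedMeasure ρ] fun y => toLinf φ (flowOf e (-t) y) := by
  set φ₁ := compLinf e.symm.toMeasurableEquiv (he.quasiMeasurePreserving_symm hρ) φ with hφ₁
  have h1 := compLinf_ae_eq e.symm.toMeasurableEquiv (he.quasiMeasurePreserving_symm hρ) φ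
  have h2 := (measurePreserving_addRight (-t)).quasiMeasurePreserving.ae h1
  have h3 := (he.quasiMeasurePreserving ρ).ae h2
  have h4 := (he.quasiMeasurePreserving ρ).ae (translation_ae_eq t φ₁)
  filter_upwards [compLinf_ae_eq e.toMeasurableEquiv (he.quasiMeasurePreserving ρ)
    (translation t φ₁), h3, h4] with x h5 h6 h7
  change toLinf (compLinf e.toMeasurableEquiv (he.quasiMeasurePreserving ρ)
    (translation t φ₁)) x = _
  rw [h5, h7, sub_eq_add_neg]
  exact h6

theorem isFlowPullback_flowGroup (he : IsStraightening a e) (hρ : volume ≪ weightedMeasure ρ) :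
    IsFlowPullback (fun t => flowOf e t) (flowGroup he hρ) where
  quasi t := he.quasiMeasurePreserving_flowOf t hρ
  apply := flowGroup_ae_eq he hρ

theorem flowGroup_nonneg (he : IsStraightening a e) (hρ : volume ≪ weightedMeasure ρ) (t : ℝ)
    (φ : WeakStarLinf (weightedMeasure ρ)) (hφ : IsNonnegLinf φ) :
    IsNonnegLinf (flowGroup he hρ t φ) :=
  compLinf_nonneg _ (he.quasiMeasurePreserving ρ)
    (compLinf_nonneg _ (measurePreserving_addRight (-t)).quasiMeasurePreserving
      (compLinf_nonneg _ (he.quasiMeasurePreserving_symm hρ) hφ))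

end Flow

/-! ### The vector field and its square on test functions -/

section VectorField

variable {a ρ : ℝ → ℝ} {e : ℝ ≃ₜ ℝ}

/-- The difference quotients of a test function along the flow are bounded and converge pointwise,
so that `X_max` is contained in the generator of the flow group. -/
theorem vectorFieldGraph_le_generatorGraph (he : IsStraightening a e) (hac : Continuous a)
    (hρ : volume ≪ weightedMeasure ρ) :
    vectorFieldGraph a ρ 1 le_rfl ≤ generatorGraph (flowGroup he hρ) := by
  rintro ⟨φ, η⟩ ⟨u, hu, hc, hφ, hη⟩
  rw [mem_generatorGraph]
  have hv : Continuous fun x => (a x : ℂ) * deriv u x :=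
    (Complex.continuous_ofReal.comp hac).mul (hu.continuous_deriv le_rfl)
  obtain ⟨C, hC⟩ := (hc.deriv.mul_left (f := fun x => (a x : ℂ))).exists_bound_of_continuous hv
  have hd : ∀ x t, HasDerivAt (fun t => u (flowOf e (-t) x))
      (-((a (flowOf e (-t) x) : ℂ) * deriv u (flowOf e (-t) x))) t := by
    intro x t
    have h1 := (he.hasDerivAt_flowOf_time (-t) x).scomp t (hasDerivAt_neg t)
    have h2 := ((hu.differentiable one_ne_zero (flowOf e (-t) x)).hasDerivAt).scomp t h1
    refine h2.congr_deriv ?_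
    simp
  have hae : ∀ t : ℝ, toLinf (((t : ℂ)⁻¹) • (φ - flowGroup he hρ t φ)) =ᵐ[weightedMeasure ρ]
      fun x => (t : ℂ)⁻¹ * (u x - u (flowOf e (-t) x)) := by
    intro t
    filter_upwards [Lp.coeFn_smul ((t : ℂ)⁻¹) (toLinf (φ - flowGroup he hρ t φ)),
      Lp.coeFn_sub (toLinf φ) (toLinf (flowGroup he hρ t φ)), flowGroup_ae_eq he hρ t φ, hφ,
      (he.quasiMeasurePreserving_flowOf (-t) hρ).ae hφ] with x h1 h2 h3 h4 h5
    rw [map_smul, h1, Pi.smul_apply, map_sub, h2, Pi.sub_apply, h3, h4, h5, smul_eq_mul]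
  refine tendsto_weakStar_of_bounded hae hη C ?_ fun x => ?_
  · filter_upwards [self_mem_nhdsWithin] with t ht x
    have ht0 : (0 : ℝ) < t := ht
    have := convex_univ.norm_image_sub_le_of_norm_hasDerivWithin_le (C := C)
      (fun r _ => (hd x r).hasDerivWithinAt) (fun r _ => by rw [norm_neg]; exact hC _)
      (Set.mem_univ t) (Set.mem_univ 0)
    rw [neg_zero, show flowOf e 0 x = x by simp [flowOf_apply], zero_sub, norm_neg,
      Real.norm_of_nonneg ht0.le] at this
    rw [norm_mul, norm_inv, Complex.norm_real, Real.norm_of_nonneg ht0.le, inv_mul_le_iff₀ ht0,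
      mul_comm]
    exact this
  · have h1 := ((hd x 0).tendsto_slope.mono_left (nhdsWithin_mono 0 (s := Set.Ioi 0)
      fun t ht => (Set.mem_Ioi.1 ht).ne')).neg
    have h0 : flowOf e 0 x = x := by simp [flowOf_apply]
    simp only [neg_zero, h0, neg_neg] at h1
    refine h1.congr fun t => ?_
    simp only [slope, vsub_eq_sub, sub_zero, neg_zero, h0, Complex.real_smul, Complex.ofReal_inv]
    ring

theorem flowGroup_mem_vectorFieldGraph (he : IsStraightening a e) (ha : ∀ x, 0 < a x)
    (hac : Continuous a) (hρ : volume ≪ weightedMeasure ρ) (t : ℝ)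
    {p : WeakStarLinf (weightedMeasure ρ) × WeakStarLinf (weightedMeasure ρ)}
    (hp : p ∈ vectorFieldGraph a ρ 1 le_rfl) :
    (flowGroup he hρ t p.1, flowGroup he hρ t p.2) ∈ vectorFieldGraph a ρ 1 le_rfl := by
  obtain ⟨u, hu, hc, h1, h2⟩ := hp
  have hd : ∀ x, HasDerivAt (flowOf e (-t)) (a (flowOf e (-t) x) * (a x)⁻¹) x :=
    he.hasDerivAt_flowOf (-t)
  have hflow : ContDiff ℝ 1 (flowOf e (-t)) := by
    rw [contDiff_one_iff_deriv]
    refine ⟨fun x => (hd x).differentiableAt, ?_⟩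
    rw [funext fun x => (hd x).deriv]
    exact (hac.comp (flowOf e (-t)).continuous).mul (hac.inv₀ fun x => (ha x).ne')
  refine ⟨u ∘ flowOf e (-t), hu.comp hflow, hc.comp_homeomorph _, ?_, ?_⟩
  · filter_upwards [flowGroup_ae_eq he hρ t p.1, (he.quasiMeasurePreserving_flowOf (-t) hρ).ae h1]
      with x h3 h4
    rw [h3, h4]
    rfl
  · filter_upwards [flowGroup_ae_eq he hρ t p.2, (he.quasiMeasurePreserving_flowOf (-t) hρ).ae h2]
      with x h3 h4
    have h5 := ((hu.differentiable one_ne_zero (flowOf e (-t) x)).hasDerivAt).scomp x (hd x)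
    rw [h3, h4, h5.deriv, Complex.real_smul]
    have : (a x : ℂ) ≠ 0 := by simpa using (ha x).ne'
    push_cast
    field_simp

/-- The class in `L_∞` of a function, or `0` if the function is not essentially bounded. -/
def linfClass (μ : Measure ℝ) (v : ℝ → ℂ) : WeakStarLinf μ :=
  open Classical in if h : MemLp v ⊤ μ then toLinf.symm (h.toLp v) else 0

theorem linfClass_ae_eq {μ : Measure ℝ} {v : ℝ → ℂ} (hv : Continuous v)
    (hc : HasCompactSupport v) : toLinf (linfClass μ v) =ᵐ[μ] v := by
  obtain ⟨C, hC⟩ := hc.exists_bound_of_continuous hv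
  have h : MemLp v ⊤ μ := memLp_top_of_bound hv.aestronglyMeasurable C (ae_of_all _ hC)
  rw [linfClass, dif_pos h]
  exact h.coeFn_toLp

/-- In the straightening coordinate the vector field is `d/dx`. -/
theorem comp_mem_vectorFieldGraph (he : IsStraightening a e) (ha : ∀ x, 0 < a x)
    (hac : Continuous a) {v : ℝ → ℂ} (hv : ContDiff ℝ 1 v) (hc : HasCompactSupport v) :
    (linfClass (weightedMeasure ρ) (v ∘ e), linfClass (weightedMeasure ρ) (deriv v ∘ e)) ∈
      vectorFieldGraph a ρ 1 le_rfl := by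
  have hecd : ContDiff ℝ 1 e := by
    rw [contDiff_one_iff_deriv]
    refine ⟨fun x => (he.hasDerivAt x).differentiableAt, ?_⟩
    rw [funext fun x => (he.hasDerivAt x).deriv]
    exact hac.inv₀ fun x => (ha x).ne'
  refine ⟨v ∘ e, hv.comp hecd, hc.comp_homeomorph e,
    linfClass_ae_eq (hv.continuous.comp e.continuous) (hc.comp_homeomorph e), ?_⟩
  filter_upwards [linfClass_ae_eq (μ := weightedMeasure ρ)
    ((hv.continuous_deriv le_rfl).comp e.continuous) (hc.deriv.comp_homeomorph e)] with x hx
  have h5 := ((hv.differentiable one_ne_zero (e x)).hasDerivAt).scomp x (he.hasDerivAt x)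
  rw [hx, h5.deriv, Complex.real_smul]
  have : (a x : ℂ) ≠ 0 := by simpa using (ha x).ne'
  push_cast
  field_simp
  rfl

/-- The functions `v ∘ e`, with `v` a test function, have no common annihilator in `L_1`. -/
theorem eq_zero_of_evalAt_comp {μ : Measure ℝ} [SigmaFinite μ] (e : ℝ ≃ₜ ℝ) {ψ : Lp ℂ 1 μ}
    (h : ∀ v : ℝ → ℂ, ContDiff ℝ ∞ v → HasCompactSupport v →
      evalAt ψ (linfClass μ (v ∘ e)) = 0) : ψ = 0 := by
  have hψ : Integrable ψ μ := L1.integrable_coeFn ψ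
  have hi : Integrable (ψ ∘ e.symm) (μ.map e) := by
    have := integrable_map_equiv (μ := μ) e.toMeasurableEquiv (ψ ∘ e.symm)
    refine this.2 (hψ.congr (ae_of_all _ fun x => ?_))
    simp
  have h0 : ∀ᵐ y ∂(μ.map e), (ψ ∘ e.symm) y = 0 := by
    refine ae_eq_zero_of_integral_contDiff_smul_eq_zero hi.locallyIntegrable fun g hg hgc => ?_
    have hv : ContDiff ℝ ∞ fun x => (g x : ℂ) := Complex.ofRealCLM.contDiff.comp hg
    have hvc : HasCompactSupport fun x => (g x : ℂ) := hgc.comp_left Complex.ofReal_zero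
    have h1 := h _ hv hvc
    rw [evalAt_apply] at h1
    have h2 := integral_map_equiv (μ := μ) e.toMeasurableEquiv
      (fun y => g y • (ψ ∘ e.symm) y)
    refine h2.trans (Eq.trans (integral_congr_ae ?_) h1)
    filter_upwards [linfClass_ae_eq (μ := μ) (hv.continuous.comp e.continuous)
      (hvc.comp_homeomorph e)] with x hx
    rw [hx]
    simp
  rw [Lp.eq_zero_iff_ae_eq_zero]
  have h1 := ae_of_ae_map e.continuous.aemeasurable h0
  filter_upwards [h1] with x hx
  simpa using hx

end VectorField

/-! ### Squares of partially defined operators -/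

section Square

theorem mem_graph_neg_pmapSq {V : Type*} [AddCommGroup V] [Module ℂ V] {A : V →ₗ.[ℂ] V} {φ η : V} :
    (φ, η) ∈ (-pmapSq A).graph ↔ ∃ ξ, (φ, ξ) ∈ A.graph ∧ (ξ, -η) ∈ A.graph := by
  rw [LinearPMap.mem_graph_iff]
  constructor
  · rintro ⟨⟨y, hy⟩, h1, h2⟩
    obtain ⟨hy1, hy2⟩ := (show ∃ h : y ∈ A.domain, A ⟨y, h⟩ ∈ A.domain from hy)
    have h1' : y = φ := h1
    subst h1'
    refine ⟨A ⟨y, hy1⟩, A.mem_graph ⟨y, hy1⟩, ?_⟩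
    have : (-pmapSq A) ⟨y, hy⟩ = -A ⟨A ⟨y, hy1⟩, hy2⟩ := rfl
    have h3 : -η = A ⟨A ⟨y, hy1⟩, hy2⟩ := by
      rw [← show _ = η from h2, this, neg_neg]
    rw [h3]
    exact A.mem_graph ⟨_, hy2⟩
  · rintro ⟨ξ, h1, h2⟩
    obtain ⟨y, hy1, hy2⟩ := (LinearPMap.mem_graph_iff A).1 h1
    obtain ⟨z, hz1, hz2⟩ := (LinearPMap.mem_graph_iff A).1 h2
    simp only at hy1 hy2 hz1 hz2
    subst hy1
    have hz : (z : V) = A y := hz1.trans hy2.symm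
    have hmem : A y ∈ A.domain := hz ▸ z.2
    refine ⟨⟨y, y.2, hmem⟩, rfl, ?_⟩
    have : (-pmapSq A) ⟨y, y.2, hmem⟩ = -A ⟨A y, hmem⟩ := rfl
    rw [this, show (⟨A y, hmem⟩ : A.domain) = z from Subtype.ext hz.symm, hz2, neg_neg]

theorem isClosable_of_topologicalClosure {μ : Measure ℝ}
    {A : WeakStarLinf μ →ₗ.[ℂ] WeakStarLinf μ}
    {G : Submodule ℂ (WeakStarLinf μ × WeakStarLinf μ)} (hG : A.graph.topologicalClosure = G)
    (h : ∀ p ∈ G, p.1 = 0 → p.2 = 0) : A.IsClosable ∧ A.closure.graph = G := by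
  have hA : A.IsClosable := ⟨G.toLinearPMap, by rw [Submodule.toLinearPMap_graph_eq G h, hG]⟩
  exact ⟨hA, by rw [← hA.graph_closure_eq_closure_graph, hG]⟩

end Square

/-! ### Mollification -/

section Mollification

/-- A smooth bump at the origin of radius `1 / (n + 1)`. -/
def mollifier (n : ℕ) : ContDiffBump (0 : ℝ) where
  rIn := 1 / (2 * (n + 1))
  rOut := 1 / (n + 1)
  rIn_pos := by positivity
  rIn_lt_rOut := by
    have : (0 : ℝ) < n + 1 := by positivity
    exact one_div_lt_one_div_of_lt this (by linarith)

theorem mollifier_rOut_le_one (n : ℕ) : (mollifier n).rOut ≤ 1 := by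
  change (1 : ℝ) / (n + 1) ≤ 1
  rw [div_le_one (by positivity)]
  linarith [(Nat.cast_nonneg n : (0 : ℝ) ≤ n)]

/-- The regularization of `u` by the `n`-th mollifier. -/
def mollify (n : ℕ) (u : ℝ → ℂ) : ℝ → ℂ :=
  convolution ((mollifier n).normed volume) u (ContinuousLinearMap.lsmul ℝ ℝ) volume

variable {u : ℝ → ℂ}

theorem contDiff_mollify (n : ℕ) (hu : Continuous u) : ContDiff ℝ ∞ (mollify n u) :=
  (mollifier n).hasCompactSupport_normed.contDiff_convolution_left _
    (mollifier n).contDiff_normed hu.locallyIntegrable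

theorem hasCompactSupport_mollify (n : ℕ) (hc : HasCompactSupport u) :
    HasCompactSupport (mollify n u) :=
  (mollifier n).hasCompactSupport_normed.convolution _ hc

theorem support_mollify_subset {R : ℝ} (h : Function.support u ⊆ Metric.closedBall 0 R) (n : ℕ) :
    Function.support (mollify n u) ⊆ Metric.closedBall 0 (R + 1) := by
  refine (support_convolution_subset _).trans ?_
  rintro _ ⟨x, hx, y, hy, rfl⟩
  rw [ContDiffBump.support_normed_eq] at hx
  have hy' := h hy
  rw [mem_ball_zero_iff] at hx
  rw [mem_closedBall_zero_iff] at hy' ⊢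
  have := mollifier_rOut_le_one n
  refine (norm_add_le x y).trans ?_
  linarith

theorem norm_mollify_le {C : ℝ} (h : ∀ x, ‖u x‖ ≤ C) (n : ℕ) (x : ℝ) : ‖mollify n u x‖ ≤ C := by
  have hi := (mollifier n).integrable_normed (μ := (volume : Measure ℝ))
  calc ‖mollify n u x‖ ≤ ∫ t, (mollifier n).normed volume t * C := by
        refine norm_integral_le_of_norm_le (hi.mul_const C) (ae_of_all _ fun t => ?_)
        rw [ContinuousLinearMap.lsmul_apply, norm_smul,
          Real.norm_of_nonneg ((mollifier n).nonneg_normed t)]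
        exact mul_le_mul_of_nonneg_left (h _) ((mollifier n).nonneg_normed t)
    _ = C := by rw [integral_mul_const, ContDiffBump.integral_normed, one_mul]

theorem tendsto_mollify (hu : Continuous u) (x : ℝ) :
    Tendsto (fun n => mollify n u x) atTop (𝓝 (u x)) :=
  ContDiffBump.convolution_tendsto_right_of_continuous
    (tendsto_one_div_add_atTop_nhds_zero_nat (𝕜 := ℝ)) hu x

theorem deriv_mollify (hu : ContDiff ℝ 1 u) (hc : HasCompactSupport u) (n : ℕ) :
    deriv (mollify n u) = mollify n (deriv u) := by
  funext x
  exact (hc.hasDerivAt_convolution_right _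
    (mollifier n).integrable_normed.locallyIntegrable hu x).deriv

/-- Pointwise convergence with a uniform bound. -/
def BoundedlyTendsto (f : ℕ → ℝ → ℂ) (v : ℝ → ℂ) : Prop :=
  (∃ C : ℝ, ∀ n x, ‖f n x‖ ≤ C) ∧ ∀ x, Tendsto (fun n => f n x) atTop (𝓝 (v x))

theorem BoundedlyTendsto.add {f g : ℕ → ℝ → ℂ} {v w : ℝ → ℂ} (hf : BoundedlyTendsto f v)
    (hg : BoundedlyTendsto g w) : BoundedlyTendsto (fun n x => f n x + g n x) fun x => v x + w x := by
  obtain ⟨⟨C, hC⟩, hf⟩ := hf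
  obtain ⟨⟨D, hD⟩, hg⟩ := hg
  exact ⟨⟨C + D, fun n x => (norm_add_le _ _).trans (add_le_add (hC n x) (hD n x))⟩,
    fun x => (hf x).add (hg x)⟩

/-- The mollifications of a compactly supported function have their supports in a common compact
set, so that they may be multiplied by an arbitrary continuous function. -/
theorem boundedlyTendsto_mul_mollify {c : ℝ → ℂ} (hcc : Continuous c) (hu : Continuous u)
    (hc : HasCompactSupport u) :
    BoundedlyTendsto (fun n x => c x * mollify n u x) fun x => c x * u x := by
  obtain ⟨C, hC⟩ := hc.exists_bound_of_continuous hu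
  obtain ⟨R, hR⟩ := hc.isBounded.subset_closedBall 0
  obtain ⟨D, hD⟩ := (isCompact_closedBall (0 : ℝ) (R + 1)).exists_bound_of_continuousOn
    hcc.continuousOn
  have hC0 : 0 ≤ C := (norm_nonneg _).trans (hC 0)
  refine ⟨⟨|D| * C, fun n x => ?_⟩, fun x => (tendsto_mollify hu x).const_mul _⟩
  by_cases hx : x ∈ Metric.closedBall (0 : ℝ) (R + 1)
  · rw [norm_mul]
    exact mul_le_mul ((hD x hx).trans (le_abs_self D)) (norm_mollify_le hC n x) (norm_nonneg _)
      (abs_nonneg D)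
  · have : mollify n u x = 0 := by
      by_contra hne
      exact hx (support_mollify_subset ((subset_tsupport u).trans hR) n hne)
    simp only [this, mul_zero, norm_zero]
    positivity

theorem tendsto_linfClass {μ : Measure ℝ} [SigmaFinite μ] {f : ℕ → ℝ → ℂ} {v : ℝ → ℂ}
    (h : BoundedlyTendsto f v) (hf : ∀ n, Continuous (f n)) (hfc : ∀ n, HasCompactSupport (f n))
    {φ : WeakStarLinf μ} (hφ : toLinf φ =ᵐ[μ] v) :
    Tendsto (fun n => linfClass μ (f n)) atTop (𝓝 φ) := by
  obtain ⟨⟨C, hC⟩, h⟩ := h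
  exact tendsto_weakStar_of_bounded (fun n => linfClass_ae_eq (hf n) (hfc n)) hφ C
    (Eventually.of_forall hC) h

variable {a ρ : ℝ → ℝ}

/-- Mollification shows that `X_max` is contained in the closure of `X_min`. -/
theorem vectorFieldGraph_le_topologicalClosure (ha : Continuous a) :
    vectorFieldGraph a ρ 1 le_rfl ≤
      (vectorFieldGraph a ρ ∞ (by norm_cast)).topologicalClosure := by
  rintro ⟨φ, η⟩ ⟨u, hu, hc, hφ, hη⟩
  have hac : Continuous fun x => (a x : ℂ) := Complex.continuous_ofReal.comp ha
  have hu' := hu.continuous_deriv le_rfl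
  have hw : ∀ n, Continuous fun x => (a x : ℂ) * mollify n (deriv u) x := fun n =>
    hac.mul (contDiff_mollify n hu').continuous
  have hwc : ∀ n, HasCompactSupport fun x => (a x : ℂ) * mollify n (deriv u) x := fun n =>
    (hasCompactSupport_mollify n hc.deriv).mul_left
  have t1 : Tendsto (fun n => linfClass (weightedMeasure ρ) (mollify n u)) atTop (𝓝 φ) := by
    refine tendsto_linfClass ?_ (fun n => (contDiff_mollify n hu.continuous).continuous)
      (fun n => hasCompactSupport_mollify n hc) hφ
    simpa using boundedlyTendsto_mul_mollify (c := fun _ => 1) continuous_const hu.continuous hc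
  have t2 := tendsto_linfClass (boundedlyTendsto_mul_mollify hac hu' hc.deriv) hw hwc hη
  refine mem_closure_of_tendsto (t1.prodMk_nhds t2) (Eventually.of_forall fun n => ?_)
  refine ⟨mollify n u, contDiff_mollify n hu.continuous, hasCompactSupport_mollify n hc,
    linfClass_ae_eq (contDiff_mollify n hu.continuous).continuous (hasCompactSupport_mollify n hc),
    ?_⟩
  rw [deriv_mollify hu hc]
  exact linfClass_ae_eq (hw n) (hwc n)

/-- For smooth `a`, mollification shows that `H_max` is contained in the closure of `H_min`. -/
theorem graph_opHmax_le_topologicalClosure (ha : ∀ x, 0 < a x) (has : ContDiff ℝ ∞ a)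
    (hρ : ∀ x, 0 < ρ x) (hρc : Continuous ρ) :
    (opHmax a ρ).graph ≤ (opHmin a ρ).graph.topologicalClosure := by
  rintro ⟨φ, η⟩ hp
  obtain ⟨ξ, h1, h2⟩ := mem_graph_neg_pmapSq.1 hp
  rw [opXmax, vectorField_graph a hρ hρc] at h1 h2
  obtain ⟨u, hu, hc, hφ, hξ⟩ := h1
  obtain ⟨u₂, hu₂, hc₂, hξ₂, hη⟩ := h2
  have hvol := volume_absolutelyContinuous_weightedMeasure hρ hρc
  have hA : ContDiff ℝ ∞ fun x => (a x : ℂ) := Complex.ofRealCLM.contDiff.comp has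
  have hac : Continuous fun x => (a x : ℂ) := hA.continuous
  have hA' : Continuous (deriv fun x => (a x : ℂ)) := hA.continuous_deriv (by norm_cast)
  have hu' := hu.continuous_deriv le_rfl
  have ha0 : ∀ x, (a x : ℂ) ≠ 0 := fun x => by simpa using (ha x).ne'
  -- the intermediate function is `a u'`, and `u` is therefore twice differentiable
  have heq : u₂ = fun x => (a x : ℂ) * deriv u x :=
    (hu₂.continuous.ae_eq_iff_eq volume (hac.mul hu')).1 (hvol.ae_eq (hξ₂.symm.trans hξ))
  have hdu : ContDiff ℝ 1 (deriv u) := by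
    have : deriv u = fun x => (a x)⁻¹ • u₂ x := by
      funext x
      rw [heq, Complex.real_smul, Complex.ofReal_inv, inv_mul_cancel_left₀ (ha0 x)]
    rw [this]
    have has1 : ContDiff ℝ 1 a := has.of_le (by norm_cast)
    exact (has1.inv fun x => (ha x).ne').smul hu₂
  have hu'' := hdu.continuous_deriv le_rfl
  have hderiv : ∀ {w : ℝ → ℂ}, ContDiff ℝ 1 w → ∀ x, deriv (fun x => (a x : ℂ) * w x) x =
      deriv (fun x => (a x : ℂ)) x * w x + (a x : ℂ) * deriv w x := fun {w} hw x =>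
    deriv_fun_mul (hA.differentiable (by norm_cast) x) (hw.differentiable one_ne_zero x)
  set w : ℕ → ℝ → ℂ := fun n x => (a x : ℂ) * mollify n (deriv u) x with hw
  have hwd : ∀ n, ContDiff ℝ ∞ (w n) := fun n => hA.mul (contDiff_mollify n hu')
  have hwc : ∀ n, HasCompactSupport (w n) := fun n =>
    (hasCompactSupport_mollify n hc.deriv).mul_left
  have hwd' : ∀ n, Continuous fun x => (a x : ℂ) * deriv (w n) x := fun n =>
    hac.mul ((hwd n).continuous_deriv (by norm_cast))
  have hwc' : ∀ n, HasCompactSupport fun x => (a x : ℂ) * deriv (w n) x := fun n =>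
    (hwc n).deriv.mul_left
  have t1 : Tendsto (fun n => linfClass (weightedMeasure ρ) (mollify n u)) atTop (𝓝 φ) := by
    refine tendsto_linfClass ?_ (fun n => (contDiff_mollify n hu.continuous).continuous)
      (fun n => hasCompactSupport_mollify n hc) hφ
    simpa using boundedlyTendsto_mul_mollify (c := fun _ => 1) continuous_const hu.continuous hc
  have t2 : Tendsto (fun n => linfClass (weightedMeasure ρ) fun x => (a x : ℂ) * deriv (w n) x)
      atTop (𝓝 (-η)) := by
    refine tendsto_linfClass ?_ hwd' hwc' hη
    have h3 := (boundedlyTendsto_mul_mollify (hac.mul hA') hu' hc.deriv).add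
      (boundedlyTendsto_mul_mollify (hac.mul hac) hu'' hc.deriv.deriv)
    convert h3 using 2
    · funext x
      rw [hw, hderiv ((contDiff_mollify _ hu').of_le (by norm_cast)), deriv_mollify hdu hc.deriv]
      simp only [Pi.mul_apply]
      ring
    · rw [heq, hderiv hdu]
      simp only [Pi.mul_apply]
      ring
  have t3 := t2.neg
  rw [neg_neg] at t3
  refine mem_closure_of_tendsto (t1.prodMk_nhds t3) (Eventually.of_forall fun n => ?_)
  refine mem_graph_neg_pmapSq.2 ⟨linfClass (weightedMeasure ρ) (w n), ?_, ?_⟩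
  · rw [opXmin, vectorField_graph a hρ hρc]
    refine ⟨mollify n u, contDiff_mollify n hu.continuous, hasCompactSupport_mollify n hc,
      linfClass_ae_eq (contDiff_mollify n hu.continuous).continuous
        (hasCompactSupport_mollify n hc), ?_⟩
    rw [deriv_mollify hu hc]
    exact linfClass_ae_eq (hwd n).continuous (hwc n)
  · rw [opXmin, vectorField_graph a hρ hρc, neg_neg]
    exact ⟨w n, hwd n, hwc n, linfClass_ae_eq (hwd n).continuous (hwc n),
      linfClass_ae_eq (hwd' n) (hwc' n)⟩

end Mollification

/-! ### The closures of the four operators -/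

section Closures

variable {a ρ : ℝ → ℝ} {e : ℝ ≃ₜ ℝ}

theorem vectorFieldGraph_infty_le : vectorFieldGraph a ρ ∞ (by norm_cast) ≤
    vectorFieldGraph a ρ 1 le_rfl := by
  rintro p ⟨u, hu, h⟩
  exact ⟨u, hu.of_le (by norm_cast), h⟩

theorem topologicalClosure_vectorFieldGraph (he : IsStraightening a e) (ha : ∀ x, 0 < a x)
    (hac : Continuous a) (hρ : volume ≪ weightedMeasure ρ) :
    (vectorFieldGraph a ρ 1 le_rfl).topologicalClosure = generatorGraph (flowGroup he hρ) := by
  refine (isAveragingGroup_flowGroup he hρ).topologicalClosure_eq_generatorGraph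
    (vectorFieldGraph_le_generatorGraph he hac hρ)
    (fun t p hp => flowGroup_mem_vectorFieldGraph he ha hac hρ t hp) fun ψ hψ => ?_
  refine eq_zero_of_evalAt_comp e fun v hv hc => ?_
  exact hψ (_, _) (comp_mem_vectorFieldGraph he ha hac (hv.of_le (by norm_cast)) hc)

theorem topologicalClosure_vectorFieldGraph_infty (he : IsStraightening a e) (ha : ∀ x, 0 < a x)
    (hac : Continuous a) (hρ : volume ≪ weightedMeasure ρ) :
    (vectorFieldGraph a ρ ∞ (by norm_cast)).topologicalClosure =
      generatorGraph (flowGroup he hρ) := by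
  rw [← topologicalClosure_vectorFieldGraph he ha hac hρ]
  exact le_antisymm (Submodule.topologicalClosure_mono vectorFieldGraph_infty_le)
    (Submodule.topologicalClosure_minimal _ (vectorFieldGraph_le_topologicalClosure hac)
      (Submodule.isClosed_topologicalClosure _))

theorem mem_graph_opHmax (hρ : ∀ x, 0 < ρ x) (hρc : Continuous ρ)
    {p : WeakStarLinf (weightedMeasure ρ) × WeakStarLinf (weightedMeasure ρ)} :
    p ∈ (opHmax a ρ).graph ↔ ∃ ξ, (p.1, ξ) ∈ vectorFieldGraph a ρ 1 le_rfl ∧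
      (ξ, -p.2) ∈ vectorFieldGraph a ρ 1 le_rfl := by
  rw [← vectorField_graph a hρ hρc]
  exact mem_graph_neg_pmapSq

theorem mem_graph_opHmin (hρ : ∀ x, 0 < ρ x) (hρc : Continuous ρ)
    {p : WeakStarLinf (weightedMeasure ρ) × WeakStarLinf (weightedMeasure ρ)} :
    p ∈ (opHmin a ρ).graph ↔ ∃ ξ, (p.1, ξ) ∈ vectorFieldGraph a ρ ∞ (by norm_cast) ∧
      (ξ, -p.2) ∈ vectorFieldGraph a ρ ∞ (by norm_cast) := by
  rw [← vectorField_graph a hρ hρc]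
  exact mem_graph_neg_pmapSq

theorem topologicalClosure_graph_opHmax (he : IsStraightening a e) (ha : ∀ x, 0 < a x)
    (hac : Continuous a) (hρ : ∀ x, 0 < ρ x) (hρc : Continuous ρ)
    (hvol : volume ≪ weightedMeasure ρ) :
    (opHmax a ρ).graph.topologicalClosure = negSqGraph (flowGroup he hvol) := by
  have hle := vectorFieldGraph_le_generatorGraph (ρ := ρ) he hac hvol
  refine (isAveragingGroup_flowGroup he hvol).topologicalClosure_eq_negSqGraph
    (fun p hp => ?_) (fun t p hp => ?_) fun ψ hψ => ?_
  · obtain ⟨ξ, h1, h2⟩ := (mem_graph_opHmax hρ hρc).1 hp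
    exact ⟨ξ, hle h1, hle h2⟩
  · obtain ⟨ξ, h1, h2⟩ := (mem_graph_opHmax hρ hρc).1 hp
    refine (mem_graph_opHmax hρ hρc).2 ⟨flowGroup he hvol t ξ,
      flowGroup_mem_vectorFieldGraph he ha hac hvol t h1, ?_⟩
    have := flowGroup_mem_vectorFieldGraph he ha hac hvol t h2
    rwa [map_neg] at this
  · refine eq_zero_of_evalAt_comp e fun v hv hc => ?_
    have hv' : ContDiff ℝ ∞ (deriv v) := (contDiff_infty_iff_deriv.1 hv).2
    have h1 := comp_mem_vectorFieldGraph (ρ := ρ) he ha hac (hv.of_le (by norm_cast)) hc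
    have h2 := comp_mem_vectorFieldGraph (ρ := ρ) he ha hac (hv'.of_le (by norm_cast)) hc.deriv
    refine hψ (_, -linfClass (weightedMeasure ρ) (deriv (deriv v) ∘ e))
      ((mem_graph_opHmax hρ hρc).2 ⟨_, h1, ?_⟩)
    rwa [neg_neg]

theorem topologicalClosure_graph_opHmin (he : IsStraightening a e) (ha : ∀ x, 0 < a x)
    (has : ContDiff ℝ ∞ a) (hρ : ∀ x, 0 < ρ x) (hρc : Continuous ρ)
    (hvol : volume ≪ weightedMeasure ρ) :
    (opHmin a ρ).graph.topologicalClosure = negSqGraph (flowGroup he hvol) := by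
  rw [← topologicalClosure_graph_opHmax he ha has.continuous hρ hρc hvol]
  refine le_antisymm (Submodule.topologicalClosure_mono fun p hp => ?_)
    (Submodule.topologicalClosure_minimal _ (graph_opHmax_le_topologicalClosure ha has hρ hρc)
      (Submodule.isClosed_topologicalClosure _))
  obtain ⟨ξ, h1, h2⟩ := (mem_graph_opHmin hρ hρc).1 hp
  exact (mem_graph_opHmax hρ hρc).2
    ⟨ξ, vectorFieldGraph_infty_le h1, vectorFieldGraph_infty_le h2⟩

theorem LinearPMap.isClosed_of_isClosed_neg {μ : Measure ℝ}
    {A : WeakStarLinf μ →ₗ.[ℂ] WeakStarLinf μ} (h : (-A).IsClosed) : A.IsClosed := by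
  have hpre : (A.graph : Set (WeakStarLinf μ × WeakStarLinf μ)) =
      (fun p => (p.1, -p.2)) ⁻¹' ((-A).graph : Set (WeakStarLinf μ × WeakStarLinf μ)) := by
    ext ⟨φ, η⟩
    rw [Set.mem_preimage, SetLike.mem_coe, SetLike.mem_coe, LinearPMap.neg_graph]
    constructor
    · exact fun h => ⟨(φ, η), h, rfl⟩
    · rintro ⟨⟨φ', η'⟩, h1, h2⟩
      obtain ⟨h3, h4⟩ := Prod.mk.inj h2
      have h3' : φ' = φ := h3
      have h4' : η' = η := neg_injective h4
      subst h3' h4'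
      exact h1
  rw [LinearPMap.IsClosed, hpre]
  exact IsClosed.preimage (continuous_fst.prodMk continuous_snd.neg) h

end Closures

end

theorem proposition2p1 (a ρ : ℝ → ℝ)
    (ha_pos : ∀ x, 0 < a x) (ha_diff : Differentiable ℝ a)
    (ha_deriv : ∀ r : ℝ, ∃ C : ℝ, ∀ x, |x| ≤ r → |deriv a x| ≤ C)
    (ha_top : Tendsto (fun r : ℝ => ∫ x in (0 : ℝ)..r, (a x)⁻¹) atTop atTop)
    (ha_bot : Tendsto (fun r : ℝ => ∫ x in r..(0 : ℝ), (a x)⁻¹) atBot atTop)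
    (hρ_pos : ∀ x, 0 < ρ x) (hρ_smooth : ContDiff ℝ ∞ ρ) :
    ((opXmin a ρ).IsClosable ∧ (opXmax a ρ).IsClosable ∧
      (opXmin a ρ).closure = (opXmax a ρ).closure ∧
      ∃ (Φ : ℝ → ℝ → ℝ)
        (T : ℝ → WeakStarLinf (weightedMeasure ρ) →L[ℂ] WeakStarLinf (weightedMeasure ρ)),
        IsFlow a Φ ∧ IsFlowPullback Φ T ∧ IsWeakStarGroup T ∧
        IsWeakStarGenerator (opXmax a ρ).closure T) ∧
    ((opHmax a ρ).IsClosable ∧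
      ∃ S : ℝ → WeakStarLinf (weightedMeasure ρ) →L[ℂ] WeakStarLinf (weightedMeasure ρ),
        IsWeakStarSemigroup S ∧ IsPositiveFamily S ∧ IsContractiveFamily S ∧
        IsHolomorphicRightHalfPlane S ∧ IsWeakStarGenerator (opHmax a ρ).closure S) ∧
    ((opHmax a ρ).closure = -pmapSq (opXmax a ρ).closure ∧
      (pmapSq (opXmax a ρ).closure).IsClosed) ∧
    (ContDiff ℝ ∞ a → (opHmin a ρ).IsClosable ∧
      (opHmin a ρ).closure = (opHmax a ρ).closure) := by
  have hac : Continuous a := ha_diff.continuous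
  have hρc : Continuous ρ := hρ_smooth.continuous
  have hvol := volume_absolutelyContinuous_weightedMeasure hρ_pos hρc
  obtain ⟨e, he⟩ := exists_isStraightening ha_pos hac ha_top ha_bot
  have hT := isAveragingGroup_flowGroup he hvol
  have hgen : ∀ p ∈ generatorGraph (flowGroup he hvol), p.1 = 0 → p.2 = 0 := by
    rintro ⟨φ, η⟩ hp rfl
    exact generatorGraph_unique hp (generatorGraph (flowGroup he hvol)).zero_mem
  have hneg : ∀ p ∈ negSqGraph (flowGroup he hvol), p.1 = 0 → p.2 = 0 := fun p hp =>
    IsAveragingGroup.negSqGraph_unique hp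
  obtain ⟨hXmax, hXmax_graph⟩ := isClosable_of_topologicalClosure (A := opXmax a ρ) (by
    rw [opXmax, vectorField_graph a hρ_pos hρc]
    exact topologicalClosure_vectorFieldGraph he ha_pos hac hvol) hgen
  obtain ⟨hXmin, hXmin_graph⟩ := isClosable_of_topologicalClosure (A := opXmin a ρ) (by
    rw [opXmin, vectorField_graph a hρ_pos hρc]
    exact topologicalClosure_vectorFieldGraph_infty he ha_pos hac hvol) hgen
  obtain ⟨hHmax, hHmax_graph⟩ := isClosable_of_topologicalClosure
    (topologicalClosure_graph_opHmax he ha_pos hac hρ_pos hρc hvol) hneg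
  have hsq : (opHmax a ρ).closure = -pmapSq (opXmax a ρ).closure := by
    refine LinearPMap.eq_of_eq_graph ?_
    ext ⟨φ, η⟩
    rw [hHmax_graph, mem_graph_neg_pmapSq, hXmax_graph]
    rfl
  refine ⟨⟨hXmin, hXmax, LinearPMap.eq_of_eq_graph (hXmin_graph.trans hXmax_graph.symm),
    fun t => flowOf e t, flowGroup he hvol, he.isFlow, isFlowPullback_flowGroup he hvol,
    hT.toIsWeakStarGroup, fun φ η => ?_⟩,
    ⟨hHmax, heatSemigroup (flowGroup he hvol), hT.isWeakStarSemigroup_heatSemigroup,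
      hT.isPositiveFamily_heatSemigroup (flowGroup_nonneg he hvol),
      hT.isContractiveFamily_heatSemigroup, hT.isHolomorphic_heatSemigroup, fun φ η => ?_⟩,
    ⟨hsq, ?_⟩, fun has => ?_⟩
  · rw [hXmax_graph, mem_generatorGraph]
  · rw [hHmax_graph, ← hT.generatorGraph_heatSemigroup, mem_generatorGraph]
  · refine LinearPMap.isClosed_of_isClosed_neg ?_
    rw [← hsq]
    exact hHmax.closure_isClosed
  · obtain ⟨hHmin, hHmin_graph⟩ := isClosable_of_topologicalClosure
      (topologicalClosure_graph_opHmin he ha_pos has hρ_pos hρc hvol) hneg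
    exact ⟨hHmin, LinearPMap.eq_of_eq_graph (hHmin_graph.trans hHmax_graph.symm)⟩
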